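/- There is an absolute constant $c>0$ such that the following holds. Let $\xi$ be a real sub-Gaussian random variable (i.e. $\mathbb{P}[|\xi|>t]\le Ce^{-at^2}$ for all $t\ge 0$, for some constants $a,C>0$) having a density with respect to Lebesgue measure bounded by $K$. Let $n$ be a nonnegative integer and let $G_n$ be an $n\times n$ random matrix such that the entries of $n^{1/2}G_n$ are independent copies of $\xi$. Let $\|\cdot\|$ denote the $\ell^2\to\ell^2$ operator norm, and for $M\in\mathbb{R}^{n\times n}$ with complex eigenvalues $\lambda_1,\dots,\lambda_n$, listed with algebraic multiplicity, let $\eta(M)=\min_{i\ne j}|\lambda_i-\lambda_j|$ (with $\eta(M)=+\infty$ if $n\le 1$). Let $A\in\mathbb{R}^{n\times n}$ be any deterministic matrix with $\|A\|\le 1$, let $\delta\in(0,1)$, let $M=A+\delta G_n$, let $K'\ge 0$ and let $0<s\le 1$. Then \[\mathbb{P}\big[\|G_n\|\le K'\ \text{and}\ \eta(M)\le s\big]\le c\,\log_2\!\left(\frac{2(1+\delta K')}{s}\right)(1+\delta K')^2\max(K^2,K^3)\,n^5\,\frac{s}{\delta^3}.\] -/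

import Mathlib

open MeasureTheory ProbabilityTheory

noncomputable section

namespace EigenvalueGap

/-- The `ℓ² → ℓ²` operator norm of a real square matrix. -/
def opNorm {n : ℕ} (A : Matrix (Fin n) (Fin n) ℝ) : ℝ :=
  ‖Matrix.toEuclideanCLM (𝕜 := ℝ) A‖

/-- The complex eigenvalues of a real square matrix, with algebraic multiplicity. -/
def eigenvalues {n : ℕ} (M : Matrix (Fin n) (Fin n) ℝ) : Multiset ℂ :=
  (M.map (algebraMap ℝ ℂ)).charpoly.roots

/-- The minimum eigenvalue gap `η(M) = min_{i ≠ j} |λᵢ - λⱼ|`, where `λ₁, …, λₙ` are the complex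
eigenvalues listed with multiplicity: `{z, w} ≤ eigenvalues M` says that `z` and `w` occur at two
different places of this list. So `η(M) = 0` if there is a multiple eigenvalue, and `η(M) = ∞`
(the infimum over no pairs) if `n ≤ 1`. -/
def gap {n : ℕ} (M : Matrix (Fin n) (Fin n) ℝ) : ENNReal :=
  ⨅ (z : ℂ) (w : ℂ) (_ : ({z, w} : Multiset ℂ) ≤ eigenvalues M), ‖z - w‖ₑ

/-- A real random variable is sub-Gaussian if `ℙ[|ξ| > t] ≤ C exp(-a t²)` for all `t ≥ 0`, for some
constants `a, C > 0`. (No centering is required.) -/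
def IsSubGaussian {Ω : Type*} [MeasurableSpace Ω] (ξ : Ω → ℝ) (P : Measure Ω) : Prop :=
  ∃ a C : ℝ, 0 < a ∧ 0 < C ∧
    ∀ t : ℝ, 0 ≤ t → P.real {ω | t < |ξ ω|} ≤ C * Real.exp (-a * t ^ 2)

/-- `ξ` has a density with respect to Lebesgue measure that is bounded by `K`. -/
def HasDensityBoundedBy {Ω : Type*} [MeasurableSpace Ω] (ξ : Ω → ℝ) (P : Measure Ω) (K : ℝ) :
    Prop :=
  HasPDF ξ P volume ∧ ∀ᵐ x ∂(volume : Measure ℝ), pdf ξ P volume x ≤ ENNReal.ofReal K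

/-- `G` is a random matrix `Gₙ(ξ)`: the entries of `√n • G` are independent copies of `ξ`. -/
def IsScaledIIDMatrix {Ω Ω' : Type*} [MeasurableSpace Ω] [MeasurableSpace Ω'] {n : ℕ}
    (G : Ω → Matrix (Fin n) (Fin n) ℝ) (P : Measure Ω) (ξ : Ω' → ℝ) (P' : Measure Ω') : Prop :=
  iIndepFun (fun (p : Fin n × Fin n) ω => √(n : ℝ) * G ω p.1 p.2) P ∧
    ∀ i j, IdentDistrib (fun ω => √(n : ℝ) * G ω i j) ξ P P'

end EigenvalueGap

end

noncomputable section

namespace EigenvalueGap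

/-! Write `R` for the norm bound `1 + δK'` on `M`, `κ = K√n/δ` for the density bound of its entries,
and work with its independent columns. If two eigenvalues `a, b` of `M` are close, both lie within
`O(s)` of a point `z` of a mesh-`s` net, so `|a - z||b - z| ≤ τ` with `τ = 8s²`. It remains to bound
this event for each `z` and sum over the net.

For fixed `z`, put the two eigenvectors in orthonormal triangular form `v, w`. In the coordinates
`j, k`, the number `(v ∧ w)_{jk}` times the area spanned by columns `j, k` of `M - z` modulo the
other columns is at most `2τ` (`norm_area_mul_le`). Since `v ∧ w` has norm one, averaging over `j,
k` with weights `|(v ∧ w)_{jk}|²`, split dyadically, reduces the problem to the probability that one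
fixed pair of columns has area at most `t` (`measure_closePairSet_le`).

Fix the other columns and let `ρ` be the length of the projection of column `k` to the plane they
leave free. Given column `k`, the area is the modulus of an affine functional of column `j` with
linear part `f` of norm `ρ`, so it is at most `t` with probability `O(κ√n t/ρ)`. Also `ρ ≤ r` has
probability `O(κ²n r²)`, so `1/ρ` is integrable and the total is `O(κ²n t)` (`pi_thinSet_le`). With
`t` of order `s²` this suffices for the `O(R/s)` net points on the real axis, but not for the
`O(R²/s²)` others.

Off the axis, `f` nearly satisfies `f (M - z) = 0` with `M` real, so no rotation of `f` is nearly
real (`im_sum_sq_ge`), and the functional is genuinely two-dimensional: a factor of order `κ√n (t/ρ)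
R/|Im z|` is gained. As `ρ⁻²` need not be integrable, half of this gain is taken through a geometric
mean, giving `t^{3/2} |Im z|^{-1/2}` (`pi_thinSet_le_of_im`). Its sum over the net is again linear
in `s`. No logarithm arises; the one in the statement is only used as a factor at least one. -/

theorem lintegral_pi_update {ι : Type*} [Fintype ι] [DecidableEq ι] {X : ι → Type*}
    [∀ i, MeasurableSpace (X i)] (μ : ∀ i, Measure (X i)) [∀ i, IsProbabilityMeasure (μ i)]
    (i : ι) {f : (∀ i, X i) → ENNReal} (hf : Measurable f) :
    ∫⁻ x, f x ∂Measure.pi μ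
      = ∫⁻ x, ∫⁻ u, f (Function.update x i u) ∂μ i ∂Measure.pi μ := by
  have hg : Measurable (lmarginal μ {i} f) := Measurable.lmarginal μ hf
  -- Averaging over the coordinate `i` is idempotent, so `f` and its average have equal marginals.
  have key := lintegral_eq_of_lmarginal_eq (μ := μ) {i} hf hg (by
    ext x
    rw [lmarginal_singleton (lmarginal μ {i} f)]
    simp only [lmarginal_update_of_mem μ (Finset.mem_singleton_self i)]
    simp)
  rw [key, lmarginal_singleton]

/-- The measure of an interval of length `2r` is at most `2κr`. -/
def SmallBall (ν : Measure ℝ) (κ : ℝ) : Prop :=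
  ∀ c r : ℝ, 0 ≤ r → ν (Metric.closedBall c r) ≤ ENNReal.ofReal (2 * κ * r)

/-! ### Small-ball bounds for affine functionals of a random column -/

section Column

variable {n : ℕ} {ν : Fin n → Measure ℝ} {κ : ℝ}

/-- Small ball estimate for an affine functional, conditionally on an event that does not depend
on one of the coordinates. -/
theorem pi_affine_inter_le [∀ i, IsProbabilityMeasure (ν i)]
    (hν : ∀ i, SmallBall (ν i) κ) (f : Fin n → ℂ) (w : ℂ) {r : ℝ} (hr : 0 ≤ r)
    (c : Fin n) (hc : f c ≠ 0) {S : Set (Fin n → ℝ)} (hS : MeasurableSet S)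
    (hSc : ∀ x u, Function.update x c u ∈ S ↔ x ∈ S) :
    Measure.pi ν ({x | ‖∑ i, f i * (x i : ℂ) + w‖ ≤ r} ∩ S)
      ≤ ENNReal.ofReal (2 * κ * r / ‖f c‖) * Measure.pi ν S := by
  have hT : MeasurableSet {x : Fin n → ℝ | ‖∑ i, f i * (x i : ℂ) + w‖ ≤ r} := by
    apply IsClosed.measurableSet
    apply isClosed_le _ continuous_const
    fun_prop
  have hm : Measurable (({x : Fin n → ℝ | ‖∑ i, f i * (x i : ℂ) + w‖ ≤ r} ∩ S).indicator
      (1 : (Fin n → ℝ) → ENNReal)) := measurable_one.indicator (hT.inter hS)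
  rw [← lintegral_indicator_one (hT.inter hS), lintegral_pi_update ν c hm,
    ← lintegral_indicator_one hS, ← lintegral_const_mul _ (measurable_one.indicator hS)]
  refine lintegral_mono fun x => ?_
  by_cases hx : x ∈ S
  · simp only [Set.indicator_of_mem hx, Pi.one_apply, mul_one]
    have hpos : 0 < ‖f c‖ := norm_pos_iff.mpr hc
    -- With the other coordinates frozen, the real part alone confines the coordinate `c` to an
    -- interval centred at `-b.re`.
    set b : ℂ := (∑ i ∈ Finset.univ.erase c, f i * (x i : ℂ) + w) / f c with hb
    have hsub : ∀ u : ℝ, (({x : Fin n → ℝ | ‖∑ i, f i * (x i : ℂ) + w‖ ≤ r} ∩ S).indicator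
        (1 : (Fin n → ℝ) → ENNReal)) (Function.update x c u)
          ≤ (Metric.closedBall (-b.re) (r / ‖f c‖)).indicator 1 u := by
      intro u
      by_cases hu : Function.update x c u ∈ {x : Fin n → ℝ | ‖∑ i, f i * (x i : ℂ) + w‖ ≤ r} ∩ S
      · have h1 : ‖∑ i, f i * ((Function.update x c u i : ℝ) : ℂ) + w‖ ≤ r := hu.1
        rw [← Finset.add_sum_erase _ _ (Finset.mem_univ c)] at h1
        have h2 : ∑ i ∈ Finset.univ.erase c, f i * ((Function.update x c u i : ℝ) : ℂ)
            = ∑ i ∈ Finset.univ.erase c, f i * (x i : ℂ) := by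
          refine Finset.sum_congr rfl fun i hi => ?_
          rw [Function.update_of_ne (Finset.ne_of_mem_erase hi)]
        rw [h2, Function.update_self] at h1
        have h3 : f c * (u : ℂ) + ∑ i ∈ Finset.univ.erase c, f i * (x i : ℂ) + w
            = f c * ((u : ℂ) + b) := by
          rw [hb]; field_simp; ring
        rw [h3, norm_mul] at h1
        have h4 : u ∈ Metric.closedBall (-b.re) (r / ‖f c‖) := by
          rw [Metric.mem_closedBall, Real.dist_eq, le_div_iff₀ hpos]
          have h5 := Complex.abs_re_le_norm ((u : ℂ) + b)
          simp only [Complex.add_re, Complex.ofReal_re] at h5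
          rw [sub_neg_eq_add]
          nlinarith
        rw [Set.indicator_of_mem h4]
        exact Set.indicator_le_self' (by simp) _
      · rw [Set.indicator_of_notMem hu]; exact zero_le
    calc _ ≤ ∫⁻ u, (Metric.closedBall (-b.re) (r / ‖f c‖)).indicator 1 u ∂ν c :=
          lintegral_mono hsub
      _ = ν c (Metric.closedBall (-b.re) (r / ‖f c‖)) :=
          lintegral_indicator_one Metric.isClosed_closedBall.measurableSet
      _ ≤ _ := by
          refine (hν c _ _ (by positivity)).trans (le_of_eq ?_)
          congr 1; ring
  · have : ∀ u, (({x : Fin n → ℝ | ‖∑ i, f i * (x i : ℂ) + w‖ ≤ r} ∩ S).indicator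
        (1 : (Fin n → ℝ) → ENNReal)) (Function.update x c u) = 0 := fun u =>
      Set.indicator_of_notMem (fun h => hx ((hSc x u).1 h.2)) _
    simp [this]

theorem pi_affine_le [∀ i, IsProbabilityMeasure (ν i)]
    (hν : ∀ i, SmallBall (ν i) κ) (f : Fin n → ℂ) (w : ℂ) {r : ℝ} (hr : 0 ≤ r)
    (c : Fin n) (hc : f c ≠ 0) :
    Measure.pi ν {x | ‖∑ i, f i * (x i : ℂ) + w‖ ≤ r} ≤ ENNReal.ofReal (2 * κ * r / ‖f c‖) := by
  have := pi_affine_inter_le hν f w hr c hc MeasurableSet.univ (by simp)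
  simpa using this

/-- A joint small ball estimate for two affine functionals in triangular position. -/
theorem pi_affine_affine_le [∀ i, IsProbabilityMeasure (ν i)] (hκ : 0 ≤ κ)
    (hν : ∀ i, SmallBall (ν i) κ) (f g : Fin n → ℂ) (w w' : ℂ) {r r' : ℝ} (hr : 0 ≤ r)
    (hr' : 0 ≤ r') (c d : Fin n) {m m' : ℝ} (hm : 0 < m) (hm' : 0 < m')
    (hc : m ≤ ‖f c‖) (hd : m' ≤ ‖g d‖) (hg : g c = 0) :
    Measure.pi ν {x | ‖∑ i, f i * (x i : ℂ) + w‖ ≤ r ∧ ‖∑ i, g i * (x i : ℂ) + w'‖ ≤ r'}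
      ≤ ENNReal.ofReal (2 * κ * r / m * (2 * κ * r' / m')) := by
  have hS : MeasurableSet {x : Fin n → ℝ | ‖∑ i, g i * (x i : ℂ) + w'‖ ≤ r'} := by
    apply IsClosed.measurableSet
    apply isClosed_le _ continuous_const
    fun_prop
  have h1 := pi_affine_inter_le hν f w hr c (norm_pos_iff.mp (hm.trans_le hc)) hS (by
    intro x u
    have : ∑ i, g i * ((Function.update x c u i : ℝ) : ℂ) = ∑ i, g i * (x i : ℂ) := by
      refine Finset.sum_congr rfl fun i _ => ?_
      by_cases hi : i = c
      · subst hi; simp [hg]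
      · rw [Function.update_of_ne hi]
    simp [this])
  have h2 := pi_affine_le hν g w' hr' d (norm_pos_iff.mp (hm'.trans_le hd))
  rw [ENNReal.ofReal_mul (by positivity)]
  refine h1.trans (mul_le_mul' (ENNReal.ofReal_le_ofReal ?_)
    (h2.trans (ENNReal.ofReal_le_ofReal ?_)))
  · gcongr
  · gcongr

end Column

open ComplexConjugate in
/-- Two vectors of `ℂⁿ` are orthonormal. -/
def OrthoPair {n : ℕ} (h₁ h₂ : Fin n → ℂ) : Prop :=
  ∑ i, ‖h₁ i‖ ^ 2 = 1 ∧ ∑ i, ‖h₂ i‖ ^ 2 = 1 ∧ ∑ i, conj (h₁ i) * h₂ i = 0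

section OrthoPair

variable {n : ℕ}

theorem OrthoPair.symm {h₁ h₂ : Fin n → ℂ} (h : OrthoPair h₁ h₂) : OrthoPair h₂ h₁ := by
  refine ⟨h.2.1, h.1, ?_⟩
  have := congrArg (starRingEnd ℂ) h.2.2
  simp only [map_sum, map_mul, Complex.conj_conj, map_zero] at this
  rw [← this]
  exact Finset.sum_congr rfl fun i _ => mul_comm _ _

theorem OrthoPair.sum_norm_sq_comb {h₁ h₂ : Fin n → ℂ} (h : OrthoPair h₁ h₂) (a b : ℂ) :
    ∑ i, ‖a * h₁ i + b * h₂ i‖ ^ 2 = ‖a‖ ^ 2 + ‖b‖ ^ 2 := by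
  have key : ∀ i, ‖a * h₁ i + b * h₂ i‖ ^ 2 = ‖a‖ ^ 2 * ‖h₁ i‖ ^ 2 + ‖b‖ ^ 2 * ‖h₂ i‖ ^ 2
      + 2 * (starRingEnd ℂ a * b * (starRingEnd ℂ (h₁ i) * h₂ i)).re := by
    intro i
    rw [Complex.sq_norm, add_comm (a * h₁ i), Complex.normSq_add, ← Complex.sq_norm,
      ← Complex.sq_norm, norm_mul, norm_mul, map_mul,
      show b * h₂ i * (starRingEnd ℂ a * starRingEnd ℂ (h₁ i))
        = starRingEnd ℂ a * b * (starRingEnd ℂ (h₁ i) * h₂ i) by ring]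
    ring
  simp_rw [key, Finset.sum_add_distrib, ← Finset.mul_sum, ← Complex.re_sum, ← Finset.mul_sum]
  rw [h.1, h.2.1, h.2.2]
  simp

theorem exists_le_norm_apply {f : Fin n → ℂ} {ρ : ℝ} (hρ : 0 < ρ) (hf : ρ ^ 2 ≤ ∑ i, ‖f i‖ ^ 2) :
    ∃ c, ρ / √(n : ℝ) ≤ ‖f c‖ ∧ ∀ i, ‖f i‖ ≤ ‖f c‖ := by
  have hne : (Finset.univ : Finset (Fin n)).Nonempty := by
    by_contra h
    rw [Finset.not_nonempty_iff_eq_empty] at h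
    rw [h, Finset.sum_empty] at hf
    nlinarith
  obtain ⟨c, -, hc⟩ := Finset.exists_max_image Finset.univ (fun i => ‖f i‖) hne
  refine ⟨c, ?_, fun i => hc i (Finset.mem_univ i)⟩
  have hn : 0 < (n : ℝ) := by exact_mod_cast c.pos
  have h1 : ρ ^ 2 ≤ n * ‖f c‖ ^ 2 := by
    refine hf.trans ((Finset.sum_le_card_nsmul _ _ (‖f c‖ ^ 2) fun i hi => ?_).trans (by simp))
    have := hc i hi
    gcongr
  rw [div_le_iff₀ (Real.sqrt_pos.mpr hn)]
  refine le_of_sq_le_sq ?_ (by positivity)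
  rw [mul_pow, Real.sq_sqrt hn.le]
  linarith

end OrthoPair

section Column

variable {n : ℕ} {ν : Fin n → Measure ℝ} {κ : ℝ}

theorem pi_orthoPair_le_of_max [∀ i, IsProbabilityMeasure (ν i)] (hκ : 0 ≤ κ)
    (hν : ∀ i, SmallBall (ν i) κ) {h₁ h₂ : Fin n → ℂ} (h : OrthoPair h₁ h₂) (w₁ w₂ : ℂ) {r : ℝ}
    (hr : 0 ≤ r) {c : Fin n} (hc : 1 / √(n : ℝ) ≤ ‖h₁ c‖) (hc' : ‖h₂ c‖ ≤ ‖h₁ c‖) :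
    Measure.pi ν {x | ‖∑ i, h₁ i * (x i : ℂ) + w₁‖ ≤ r ∧ ‖∑ i, h₂ i * (x i : ℂ) + w₂‖ ≤ r}
      ≤ ENNReal.ofReal (8 * κ ^ 2 * n * r ^ 2) := by
  have hn : 0 < (n : ℝ) := by exact_mod_cast c.pos
  have hsn : 0 < √(n : ℝ) := Real.sqrt_pos.mpr hn
  have hpos : 0 < ‖h₁ c‖ := lt_of_lt_of_le (by positivity) hc
  have hne : h₁ c ≠ 0 := norm_pos_iff.mp hpos
  -- Adding `a • h₁` to `h₂` kills the coordinate `c`. Orthonormality keeps the norm of the sum at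
  -- least one, while `‖a‖ ≤ 1` costs only a doubling of the radius.
  set a : ℂ := -(h₂ c / h₁ c) with ha
  have han : ‖a‖ ≤ 1 := by
    rw [ha, norm_neg, norm_div]
    exact div_le_one_of_le₀ hc' hpos.le
  have hsum : (1 : ℝ) ^ 2 ≤ ∑ i, ‖a * h₁ i + 1 * h₂ i‖ ^ 2 := by
    rw [h.sum_norm_sq_comb]
    have := sq_nonneg ‖a‖
    simp
  obtain ⟨d, hd, -⟩ := exists_le_norm_apply (f := fun i => a * h₁ i + 1 * h₂ i) one_pos hsum
  have hg : a * h₁ c + 1 * h₂ c = 0 := by rw [ha]; field_simp; ring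
  have h2r : 0 ≤ 2 * r := by linarith
  have key := pi_affine_affine_le hκ hν h₁ (fun i => a * h₁ i + 1 * h₂ i) w₁ (a * w₁ + w₂) hr h2r
    c d (one_div_pos.mpr hsn) (one_div_pos.mpr hsn) hc hd hg
  refine (measure_mono ?_).trans (key.trans (ENNReal.ofReal_le_ofReal (le_of_eq ?_)))
  · rintro x ⟨hx1, hx2⟩
    refine ⟨hx1, ?_⟩
    have : ∑ i, (a * h₁ i + 1 * h₂ i) * (x i : ℂ) + (a * w₁ + w₂)
        = a * (∑ i, h₁ i * (x i : ℂ) + w₁) + (∑ i, h₂ i * (x i : ℂ) + w₂) := by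
      simp_rw [add_mul, Finset.sum_add_distrib, mul_add, Finset.mul_sum, mul_assoc, one_mul]
      ring
    rw [this]
    refine (norm_add_le _ _).trans ?_
    rw [norm_mul]
    have := mul_le_mul han hx1 (norm_nonneg _) zero_le_one
    linarith
  · have := Real.sq_sqrt hn.le
    field_simp
    rw [this]; ring

/-- The projection of a random vector to a complex plane is small with small probability. -/
theorem pi_orthoPair_le [∀ i, IsProbabilityMeasure (ν i)] (hκ : 0 ≤ κ)
    (hν : ∀ i, SmallBall (ν i) κ) {h₁ h₂ : Fin n → ℂ} (h : OrthoPair h₁ h₂) (w₁ w₂ : ℂ) {r : ℝ}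
    (hr : 0 ≤ r) :
    Measure.pi ν {x | ‖∑ i, h₁ i * (x i : ℂ) + w₁‖ ≤ r ∧ ‖∑ i, h₂ i * (x i : ℂ) + w₂‖ ≤ r}
      ≤ ENNReal.ofReal (8 * κ ^ 2 * n * r ^ 2) := by
  obtain ⟨c, hc, hcm⟩ := exists_le_norm_apply one_pos (by rw [h.1]; norm_num)
  obtain ⟨d, hd, hdm⟩ := exists_le_norm_apply one_pos (by rw [h.2.1]; norm_num)
  rcases le_total ‖h₂ d‖ ‖h₁ c‖ with hle | hle
  · exact pi_orthoPair_le_of_max hκ hν h w₁ w₂ hr hc ((hdm c).trans hle)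
  · simp_rw [and_comm (a := ‖∑ i, h₁ i * _ + w₁‖ ≤ r)]
    exact pi_orthoPair_le_of_max hκ hν h.symm w₂ w₁ hr hd ((hcm d).trans hle)

theorem pi_affine_le_of_norm [∀ i, IsProbabilityMeasure (ν i)] (hκ : 0 ≤ κ)
    (hν : ∀ i, SmallBall (ν i) κ) (f : Fin n → ℂ) (w : ℂ) {t ρ : ℝ} (ht : 0 ≤ t) (hρ : 0 < ρ)
    (hf : ρ ^ 2 ≤ ∑ i, ‖f i‖ ^ 2) :
    Measure.pi ν {x | ‖∑ i, f i * (x i : ℂ) + w‖ ≤ t}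
      ≤ ENNReal.ofReal (2 * κ * √(n : ℝ) * t / ρ) := by
  obtain ⟨c, hc, -⟩ := exists_le_norm_apply hρ hf
  have hn : 0 < (n : ℝ) := by exact_mod_cast c.pos
  have hsn : 0 < √(n : ℝ) := Real.sqrt_pos.mpr hn
  have hpos : 0 < ρ / √(n : ℝ) := by positivity
  refine (pi_affine_le hν f w ht c (norm_pos_iff.mp (hpos.trans_le hc))).trans
    (ENNReal.ofReal_le_ofReal ?_)
  calc 2 * κ * t / ‖f c‖ ≤ 2 * κ * t / (ρ / √(n : ℝ)) := by gcongr
    _ = _ := by field_simp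

/-- If no rotation of `f` is nearly real, then the random variable `f · x` is genuinely
two-dimensional. -/
theorem pi_affine_le_of_im [∀ i, IsProbabilityMeasure (ν i)] (hκ : 0 ≤ κ)
    (hν : ∀ i, SmallBall (ν i) κ) (f : Fin n → ℂ) (w : ℂ) {t ρ b : ℝ} (ht : 0 ≤ t) (hρ : 0 < ρ)
    (hf : ρ ^ 2 ≤ ∑ i, ‖f i‖ ^ 2) (hb : 0 < b)
    (him : ∀ ω : ℂ, ‖ω‖ = 1 → b ^ 2 ≤ ∑ i, (ω * f i).im ^ 2) :
    Measure.pi ν {x | ‖∑ i, f i * (x i : ℂ) + w‖ ≤ t}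
      ≤ ENNReal.ofReal (2 * κ * √(n : ℝ) * t / ρ * (2 * κ * √(n : ℝ) * t / b)) := by
  obtain ⟨c, hc, -⟩ := exists_le_norm_apply hρ hf
  have hn : 0 < (n : ℝ) := by exact_mod_cast c.pos
  have hsn : 0 < √(n : ℝ) := Real.sqrt_pos.mpr hn
  have hpos : 0 < ‖f c‖ := lt_of_lt_of_le (by positivity) hc
  -- This rotation makes `ω * f c` real, so `Im (ω f)` vanishes at `c` and is in triangular position
  -- with `f`.
  set ω : ℂ := starRingEnd ℂ (f c) / ‖f c‖ with hω
  have hω1 : ‖ω‖ = 1 := by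
    rw [hω, norm_div, Complex.norm_conj, Complex.norm_real, norm_norm, div_self hpos.ne']
  have hωc : (ω * f c).im = 0 := by
    have : ω * f c = ((Complex.normSq (f c) / ‖f c‖ : ℝ) : ℂ) := by
      rw [hω, div_mul_eq_mul_div, mul_comm, Complex.mul_conj]; push_cast; rfl
    rw [this, Complex.ofReal_im]
  have hq : b ^ 2 ≤ ∑ i, ‖(((ω * f i).im : ℝ) : ℂ)‖ ^ 2 := by
    refine (him ω hω1).trans (le_of_eq (Finset.sum_congr rfl fun i _ => ?_))
    rw [Complex.norm_real, Real.norm_eq_abs, sq_abs]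
  obtain ⟨d, hd, -⟩ := exists_le_norm_apply hb hq
  have key := pi_affine_affine_le hκ hν f (fun i => (((ω * f i).im : ℝ) : ℂ)) w
    (((ω * w).im : ℝ) : ℂ) ht ht c d (m := ρ / √(n : ℝ)) (m' := b / √(n : ℝ)) (by positivity)
    (by positivity) hc hd (by simp [hωc])
  refine (measure_mono ?_).trans (key.trans (ENNReal.ofReal_le_ofReal (le_of_eq ?_)))
  · intro x hx
    refine ⟨hx, ?_⟩
    have h1 : ∑ i, (((ω * f i).im : ℝ) : ℂ) * (x i : ℂ) + (((ω * w).im : ℝ) : ℂ)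
        = (((ω * (∑ i, f i * (x i : ℂ) + w)).im : ℝ) : ℂ) := by
      rw [mul_add, Finset.mul_sum, Complex.add_im, Complex.im_sum]
      push_cast
      congr 1
      refine Finset.sum_congr rfl fun i _ => ?_
      rw [← mul_assoc, Complex.im_mul_ofReal]; push_cast; rfl
    rw [h1, Complex.norm_real, Real.norm_eq_abs]
    refine (Complex.abs_im_le_norm _).trans ?_
    rw [norm_mul, hω1, one_mul]
    exact hx
  · field_simp

end Column

/-! ### Negative moments from small balls -/

/-- A quadratic small ball estimate bounds the negative moments of order less than two. -/
theorem lintegral_rpow_neg_le {Ω : Type*} [MeasurableSpace Ω] (μ : Measure Ω)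
    [IsProbabilityMeasure μ] {ρ : Ω → ℝ} (hρ : Measurable ρ) (hρ0 : ∀ ω, 0 ≤ ρ ω) {B e : ℝ}
    (hB : 0 < B) (he : 0 < e) (he2 : e < 2)
    (h : ∀ r, 0 < r → μ {ω | ρ ω ≤ r} ≤ ENNReal.ofReal (B * r ^ 2)) :
    ∫⁻ ω, ENNReal.ofReal (ρ ω ^ (-e)) ∂μ ≤ ENNReal.ofReal (2 / (2 - e) * B ^ (e / 2)) := by
  have hnn : ∀ ω, 0 ≤ ρ ω ^ (-e) := fun ω => Real.rpow_nonneg (hρ0 ω) _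
  rw [lintegral_eq_lintegral_meas_le μ (Filter.Eventually.of_forall hnn)
    (hρ.pow_const _).aemeasurable]
  -- The layer-cake integral is cut where the tail bound `B t^{-2/e}` equals one; below this level
  -- the trivial bound is used.
  set a : ℝ := B ^ (e / 2) with ha
  have ha0 : 0 < a := by positivity
  have hset : ∀ t, 0 < t → {ω | t ≤ ρ ω ^ (-e)} ⊆ {ω | ρ ω ≤ t ^ (-e⁻¹)} := by
    intro t ht ω hω
    simp only [Set.mem_ofPred_eq] at hω ⊢
    have hpos : 0 < ρ ω := by
      rcases (hρ0 ω).eq_or_lt with h0 | h0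
      · rw [← h0, Real.zero_rpow (by linarith)] at hω; linarith
      · exact h0
    have h2 := Real.rpow_le_rpow_of_nonpos ht hω (show -e⁻¹ ≤ 0 by
      have := inv_pos.mpr he; linarith)
    rwa [← Real.rpow_mul hpos.le, show -e * -e⁻¹ = 1 by field_simp, Real.rpow_one] at h2
  have hsplit : Set.Ioi (0 : ℝ) = Set.Ioc 0 a ∪ Set.Ioi a := (Set.Ioc_union_Ioi_eq_Ioi ha0.le).symm
  have hexp : -(2 / e) < -1 := by
    have : 1 < 2 / e := by rw [lt_div_iff₀ he]; linarith
    linarith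
  have h1 : ∫⁻ t in Set.Ioc 0 a, μ {ω | t ≤ ρ ω ^ (-e)} ≤ ENNReal.ofReal a := by
    calc _ ≤ ∫⁻ t in Set.Ioc 0 a, 1 := lintegral_mono fun t => prob_le_one
      _ = _ := by simp
  have h2 : ∫⁻ t in Set.Ioi a, μ {ω | t ≤ ρ ω ^ (-e)}
      ≤ ENNReal.ofReal (B * (-a ^ (-(2 / e) + 1) / (-(2 / e) + 1))) := by
    calc _ ≤ ∫⁻ t in Set.Ioi a, ENNReal.ofReal (B * t ^ (-(2 / e))) := by
          refine setLIntegral_mono (by fun_prop) fun t ht => ?_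
          have ht0 : 0 < t := ha0.trans ht
          refine (measure_mono (hset t ht0)).trans ((h _ (by positivity)).trans (le_of_eq ?_))
          rw [← Real.rpow_natCast (t ^ (-e⁻¹)) 2, ← Real.rpow_mul ht0.le]
          congr 3
          push_cast; field_simp
      _ = _ := by
          rw [← ofReal_integral_eq_lintegral_ofReal, integral_const_mul,
            integral_Ioi_rpow_of_lt hexp ha0]
          · exact (integrableOn_Ioi_rpow_of_lt hexp ha0).const_mul B
          · refine (ae_restrict_iff' measurableSet_Ioi).mpr (Filter.Eventually.of_forall ?_)
            intro t ht
            have ht0 : 0 < t := ha0.trans ht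
            simp only [Pi.zero_apply]; positivity
  rw [hsplit]
  refine (lintegral_union_le _ _ _).trans ((add_le_add h1 h2).trans ?_)
  have hBa : B * a ^ (-(2 / e) + 1) = a := by
    rw [ha, ← Real.rpow_mul hB.le]
    nth_rewrite 1 [← Real.rpow_one B]
    rw [← Real.rpow_add hB]
    congr 1; field_simp; ring
  have h2e : 0 < 2 - e := by linarith
  have hval : B * (-a ^ (-(2 / e) + 1) / (-(2 / e) + 1)) = a * (e / (2 - e)) := by
    have hne : -(2 / e) + 1 ≠ 0 := by linarith
    have : -(2 / e) + 1 = -((2 - e) / e) := by field_simp; ring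
    calc _ = (B * a ^ (-(2 / e) + 1)) * (-1 / (-(2 / e) + 1)) := by ring
      _ = a * (-1 / (-((2 - e) / e))) := by rw [hBa, this]
      _ = _ := by field_simp
  rw [hval, ← ENNReal.ofReal_add ha0.le (by positivity)]
  refine ENNReal.ofReal_le_ofReal (le_of_eq ?_)
  field_simp; ring

/-! ### Thin pairs of columns -/

variable {n : ℕ}

/-- The real matrix with columns `x j` multiplies the norm of row vectors by at most `R`. -/
def NormLe (R : ℝ) (x : Fin n → Fin n → ℝ) : Prop :=
  ∀ p : Fin n → ℝ, ∑ j, (∑ i, p i * x j i) ^ 2 ≤ R ^ 2 * ∑ i, p i ^ 2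

/-- The bilinear product of `h` with column `j` of `M - z`, where `M` has columns `x`. -/
def colPair (z : ℂ) (x : Fin n → Fin n → ℝ) (h : Fin n → ℂ) (j : Fin n) : ℂ :=
  ∑ i, h i * (x j i : ℂ) + -(z * h j)

/-- The columns `j` and `k` of `M - z` span, modulo the other columns, a parallelogram of area at
most `t`. -/
def thinSet (z : ℂ) (R t : ℝ) (j k : Fin n) : Set (Fin n → Fin n → ℝ) :=
  {x | NormLe R x ∧ ∀ h₁ h₂ : Fin n → ℂ, OrthoPair h₁ h₂ →
    (∀ l, l ≠ j → l ≠ k → colPair z x h₁ l = 0 ∧ colPair z x h₂ l = 0) →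
    ‖colPair z x h₁ j * colPair z x h₂ k - colPair z x h₁ k * colPair z x h₂ j‖ ≤ t}

theorem isCompact_orthoPair : IsCompact {h : (Fin n → ℂ) × (Fin n → ℂ) | OrthoPair h.1 h.2} := by
  have hb : ∀ f : Fin n → ℂ, ∑ i, ‖f i‖ ^ 2 = 1 → f ∈ Metric.closedBall (0 : Fin n → ℂ) 1 := by
    intro f hf
    rw [mem_closedBall_zero_iff, pi_norm_le_iff_of_nonneg zero_le_one]
    intro i
    have h1 : ‖f i‖ ^ 2 ≤ 1 := hf ▸ Finset.single_le_sum (f := fun i => ‖f i‖ ^ 2)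
      (fun i _ => by positivity) (Finset.mem_univ i)
    exact (sq_le_one_iff₀ (norm_nonneg _)).mp h1
  refine IsCompact.of_isClosed_subset
    ((isCompact_closedBall (0 : Fin n → ℂ) 1).prod (isCompact_closedBall (0 : Fin n → ℂ) 1)) ?_
    fun h hh => ⟨hb _ hh.1, hb _ hh.2.1⟩
  unfold OrthoPair
  refine IsClosed.inter (isClosed_eq ?_ continuous_const)
    (IsClosed.inter (isClosed_eq ?_ continuous_const) (isClosed_eq ?_ continuous_const))
  · fun_prop
  · fun_prop
  · have := Complex.continuous_conj
    fun_prop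

theorem isClosed_normLe (R : ℝ) : IsClosed {x : Fin n → Fin n → ℝ | NormLe R x} := by
  simp only [NormLe, Set.ofPred_forall]
  refine isClosed_iInter fun p => isClosed_le ?_ continuous_const
  fun_prop

theorem continuous_colPair (z : ℂ) (j : Fin n) :
    Continuous fun q : (Fin n → Fin n → ℝ) × (Fin n → ℂ) => colPair z q.1 q.2 j := by
  unfold colPair
  fun_prop

/-- The condition ranges over uncountably many pairs, but these form a compact set. Its failure is a
countable union of projections of closed sets along a compact factor, and such projections are
closed. -/
theorem measurableSet_thinSet (z : ℂ) (R t : ℝ) (j k : Fin n) :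
    MeasurableSet (thinSet z R t j k) := by
  let W : ℕ → Set ((Fin n → Fin n → ℝ) × {h : (Fin n → ℂ) × (Fin n → ℂ) | OrthoPair h.1 h.2}) :=
    fun m => {q | (∀ l, l ≠ j → l ≠ k → colPair z q.1 q.2.1.1 l = 0 ∧ colPair z q.1 q.2.1.2 l = 0) ∧
      t + 1 / ((m : ℝ) + 1) ≤ ‖colPair z q.1 q.2.1.1 j * colPair z q.1 q.2.1.2 k
        - colPair z q.1 q.2.1.1 k * colPair z q.1 q.2.1.2 j‖}
  have c1 : ∀ l, Continuous fun q : (Fin n → Fin n → ℝ) ×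
      {h : (Fin n → ℂ) × (Fin n → ℂ) | OrthoPair h.1 h.2} => colPair z q.1 q.2.1.1 l := fun l =>
    (continuous_colPair z l).comp (continuous_fst.prodMk
      (continuous_fst.comp (continuous_subtype_val.comp continuous_snd)))
  have c2 : ∀ l, Continuous fun q : (Fin n → Fin n → ℝ) ×
      {h : (Fin n → ℂ) × (Fin n → ℂ) | OrthoPair h.1 h.2} => colPair z q.1 q.2.1.2 l := fun l =>
    (continuous_colPair z l).comp (continuous_fst.prodMk
      (continuous_snd.comp (continuous_subtype_val.comp continuous_snd)))
  have : CompactSpace {h : (Fin n → ℂ) × (Fin n → ℂ) | OrthoPair h.1 h.2} :=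
    isCompact_iff_compactSpace.mp isCompact_orthoPair
  have hW : ∀ m, IsClosed (W m) := by
    intro m
    have h0 : IsClosed {q : (Fin n → Fin n → ℝ) ×
        {h : (Fin n → ℂ) × (Fin n → ℂ) | OrthoPair h.1 h.2} |
        ∀ l, l ≠ j → l ≠ k → colPair z q.1 q.2.1.1 l = 0 ∧ colPair z q.1 q.2.1.2 l = 0} := by
      simp only [Set.ofPred_forall]
      exact isClosed_iInter fun l => isClosed_iInter fun _ => isClosed_iInter fun _ =>
        (isClosed_eq (c1 l) continuous_const).inter (isClosed_eq (c2 l) continuous_const)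
    exact h0.inter (isClosed_le continuous_const
      (((c1 j).mul (c2 k)).sub ((c1 k).mul (c2 j))).norm)
  have heq : thinSet z R t j k = {x | NormLe R x} ∩ (⋃ m, Prod.fst '' W m)ᶜ := by
    ext x
    constructor
    · rintro ⟨hx, hx'⟩
      refine ⟨hx, ?_⟩
      rintro hmem
      obtain ⟨m, ⟨x', h⟩, hq, rfl⟩ := Set.mem_iUnion.mp hmem
      have h1 := hx' h.1.1 h.1.2 h.2 hq.1
      have h2 := hq.2
      have : 0 < 1 / ((m : ℝ) + 1) := by positivity
      simp only at h1 h2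
      linarith
    · rintro ⟨hx, hx'⟩
      refine ⟨hx, fun h₁ h₂ hh hl => ?_⟩
      by_contra hcon
      push Not at hcon
      obtain ⟨m, hm⟩ := exists_nat_one_div_lt (sub_pos.mpr hcon)
      exact hx' (Set.mem_iUnion.mpr ⟨m, (x, ⟨(h₁, h₂), hh⟩), ⟨hl, by simp only; linarith⟩, rfl⟩)
  rw [heq]
  refine (isClosed_normLe R).measurableSet.inter (MeasurableSet.iUnion fun m => ?_).compl
  exact (isClosedMap_fst_of_compactSpace _ (hW m)).measurableSet

/-- Any `n - 2` vectors of `ℂⁿ` are orthogonal to some complex plane. -/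
theorem exists_orthoPair (z : ℂ) (x : Fin n → Fin n → ℝ) {j k : Fin n} (hjk : j ≠ k) :
    ∃ h₁ h₂ : Fin n → ℂ, OrthoPair h₁ h₂ ∧
      ∀ l, l ≠ j → l ≠ k → colPair z x h₁ l = 0 ∧ colPair z x h₂ l = 0 := by
  let T : EuclideanSpace ℂ (Fin n) →ₗ[ℂ] ({l : Fin n // l ≠ j ∧ l ≠ k} → ℂ) :=
    { toFun := fun h l => colPair z x h l
      map_add' := fun a b => by
        ext l
        simp only [colPair, PiLp.add_apply, add_mul, Finset.sum_add_distrib, Pi.add_apply]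
        ring
      map_smul' := fun a b => by
        ext l
        simp only [colPair, PiLp.smul_apply, smul_eq_mul, Pi.smul_apply, RingHom.id_apply, mul_add,
          Finset.mul_sum]
        simp only [mul_assoc]
        ring }
  have hcard : Fintype.card {l : Fin n // l ≠ j ∧ l ≠ k} + 2 = n := by
    have h1 : Fintype.card {l : Fin n // l ≠ j ∧ l ≠ k}
        = ((Finset.univ.erase j).erase k).card := by
      rw [Fintype.card_subtype]
      congr 1
      ext l
      simp [and_comm]
    rw [h1, Finset.card_erase_of_mem (by simp [hjk.symm]),
      Finset.card_erase_of_mem (Finset.mem_univ _), Finset.card_univ, Fintype.card_fin]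
    have : (j : ℕ) ≠ k := fun h => hjk (Fin.ext h)
    have := j.2; have := k.2
    omega
  have hrank : 2 ≤ Module.finrank ℂ (LinearMap.ker T) := by
    have h1 := T.finrank_range_add_finrank_ker
    have h2 : Module.finrank ℂ (LinearMap.range T) ≤ _ := Submodule.finrank_le _
    rw [Module.finrank_fintype_fun_eq_card] at h2
    rw [finrank_euclideanSpace_fin] at h1
    omega
  let b := stdOrthonormalBasis ℂ (LinearMap.ker T)
  let i₁ : Fin (Module.finrank ℂ (LinearMap.ker T)) := ⟨0, by omega⟩
  let i₂ : Fin (Module.finrank ℂ (LinearMap.ker T)) := ⟨1, by omega⟩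
  have hnorm : ∀ i, ∑ l, ‖(b i : EuclideanSpace ℂ (Fin n)) l‖ ^ 2 = 1 := by
    intro i
    rw [← EuclideanSpace.norm_sq_eq]
    have := b.norm_eq_one i
    rw [Submodule.coe_norm] at this
    rw [this]; norm_num
  have horth := b.inner_eq_zero (i := i₁) (j := i₂) (by simp [i₁, i₂])
  refine ⟨(b i₁ : EuclideanSpace ℂ (Fin n)), (b i₂ : EuclideanSpace ℂ (Fin n)),
    ⟨hnorm _, hnorm _, ?_⟩, fun l h1 h2 => ⟨?_, ?_⟩⟩
  · rw [Submodule.coe_inner, PiLp.inner_apply] at horth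
    rw [← horth]
    refine Finset.sum_congr rfl fun i _ => ?_
    rw [RCLike.inner_apply, mul_comm]
  · exact congrFun (LinearMap.mem_ker.mp (b i₁).2) ⟨l, h1, h2⟩
  · exact congrFun (LinearMap.mem_ker.mp (b i₂).2) ⟨l, h1, h2⟩

/-- Tonelli in the columns `j` and `k`: `x` supplies the remaining columns, and its own entries at
`j` and `k` are overwritten. -/
theorem pi_le_of_forall_two_columns {E : Type*} [MeasurableSpace E] (μ : Fin n → Measure E)
    [∀ i, IsProbabilityMeasure (μ i)] {j k : Fin n} {S : Set (Fin n → E)} (hS : MeasurableSet S)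
    {b : ENNReal}
    (h : ∀ x, ∫⁻ u, μ j {v | Function.update (Function.update x k u) j v ∈ S} ∂μ k ≤ b) :
    Measure.pi μ S ≤ b := by
  have hm : Measurable (S.indicator (1 : (Fin n → E) → ENNReal)) := measurable_one.indicator hS
  have hg : Measurable fun x => ∫⁻ v, S.indicator (1 : (Fin n → E) → ENNReal)
      (Function.update x j v) ∂μ j := by
    have := Measurable.lmarginal (s := {j}) μ hm
    rwa [lmarginal_singleton] at this
  rw [← lintegral_indicator_one hS, lintegral_pi_update μ j hm, lintegral_pi_update μ k hg]
  calc _ ≤ ∫⁻ _, b ∂Measure.pi μ := by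
        refine lintegral_mono fun x => le_trans (le_of_eq ?_) (h x)
        refine lintegral_congr fun u => ?_
        have hset : MeasurableSet {v | Function.update (Function.update x k u) j v ∈ S} :=
          (measurable_update _) hS
        rw [← lintegral_indicator_one hset]
        rfl
    _ = b := by simp

theorem colPair_comb (z : ℂ) (x : Fin n → Fin n → ℝ) (h₁ h₂ : Fin n → ℂ) (a b : ℂ) (l : Fin n) :
    colPair z x (fun i => a * h₁ i + b * h₂ i) l = a * colPair z x h₁ l + b * colPair z x h₂ l := by
  simp only [colPair, add_mul, Finset.sum_add_distrib, mul_add, Finset.mul_sum, mul_assoc]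
  ring

/-- An approximate left eigenvector of a real matrix, for an eigenvalue which is far from the real
line, is not close to a multiple of a real vector. -/
theorem im_sum_sq_ge {z : ℂ} {R t ρ : ℝ} {x : Fin n → Fin n → ℝ} (hx : NormLe R x) (hR : 0 < R)
    (hre : |z.re| ≤ 2 * R) (him : |z.im| ≤ 2 * R) {f : Fin n → ℂ} {j : Fin n}
    (hf : ∀ l, l ≠ j → colPair z x f l = 0) (hfj : ‖colPair z x f j‖ ≤ t) (hρ : 0 < ρ)
    (hfρ : ∑ i, ‖f i‖ ^ 2 = ρ ^ 2) (ht : 4 * t ≤ |z.im| * ρ) {ω : ℂ} (hω : ‖ω‖ = 1) :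
    (|z.im| * ρ / (7 * R)) ^ 2 ≤ ∑ i, (ω * f i).im ^ 2 := by
  let p : EuclideanSpace ℝ (Fin n) := WithLp.toLp 2 fun i => (ω * f i).re
  let q : EuclideanSpace ℝ (Fin n) := WithLp.toLp 2 fun i => (ω * f i).im
  let Xq : EuclideanSpace ℝ (Fin n) := WithLp.toLp 2 fun l => ∑ i, (ω * f i).im * x l i
  let e : EuclideanSpace ℝ (Fin n) := WithLp.toLp 2 fun l => (ω * colPair z x f l).im
  -- This is the imaginary part of `ω f (M - z)`, with `ω f = p + iq` and `M` real. The error `e`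
  -- lives in the coordinate `j` only.
  have heq : z.im • p = Xq - z.re • q - e := by
    ext l
    have h1 : ω * colPair z x f l
        = ∑ i, (ω * f i) * (x l i : ℂ) + -(z * (ω * f l)) := by
      simp only [colPair, mul_add, Finset.mul_sum]
      congr 1
      · exact Finset.sum_congr rfl fun i _ => by ring
      · ring
    have h2 : (ω * colPair z x f l).im
        = ∑ i, (ω * f i).im * x l i - (z.re * (ω * f l).im + z.im * (ω * f l).re) := by
      rw [h1, Complex.add_im, Complex.im_sum, Complex.neg_im, Complex.mul_im z]
      simp only [Complex.im_mul_ofReal]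
      ring
    simp only [p, q, Xq, e, PiLp.smul_apply, PiLp.sub_apply, smul_eq_mul]
    rw [h2]; ring
  have hq2 : ‖q‖ ^ 2 = ∑ i, (ω * f i).im ^ 2 := by
    rw [EuclideanSpace.norm_sq_eq]; simp [q]
  have hp2 : ‖p‖ ^ 2 = ∑ i, (ω * f i).re ^ 2 := by
    rw [EuclideanSpace.norm_sq_eq]; simp [p]
  have hpq : ‖p‖ ^ 2 + ‖q‖ ^ 2 = ρ ^ 2 := by
    rw [hp2, hq2, ← hfρ, ← Finset.sum_add_distrib]
    refine Finset.sum_congr rfl fun i _ => ?_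
    rw [← one_mul ‖f i‖, ← hω, ← norm_mul, Complex.sq_norm, Complex.normSq_apply]; ring
  have hXq : ‖Xq‖ ≤ R * ‖q‖ := by
    refine le_of_sq_le_sq ?_ (by positivity)
    rw [mul_pow, hq2, EuclideanSpace.norm_sq_eq]
    simpa [Xq] using hx fun i => (ω * f i).im
  have he : ‖e‖ ≤ t := by
    have ht0 : 0 ≤ t := (norm_nonneg _).trans hfj
    refine le_of_sq_le_sq ?_ ht0
    rw [EuclideanSpace.norm_sq_eq, Finset.sum_eq_single j]
    · simp only [e, Real.norm_eq_abs]
      have : |(ω * colPair z x f j).im| ≤ t :=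
        (Complex.abs_im_le_norm _).trans (by rw [norm_mul, hω, one_mul]; exact hfj)
      gcongr
    · intro l _ hl
      simp [e, hf l hl]
    · simp
  have hmain : |z.im| * ‖p‖ ≤ 3 * R * ‖q‖ + t := by
    have h1 : ‖z.im • p‖ = |z.im| * ‖p‖ := by rw [norm_smul, Real.norm_eq_abs]
    have h2 : ‖z.re • q‖ = |z.re| * ‖q‖ := by rw [norm_smul, Real.norm_eq_abs]
    have h3 := norm_sub_le (Xq - z.re • q) e
    have h4 := norm_sub_le Xq (z.re • q)
    rw [← h1, heq]
    have h5 : |z.re| * ‖q‖ ≤ 2 * R * ‖q‖ := by gcongr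
    linarith
  rw [← hq2]
  have hy := abs_nonneg z.im
  generalize |z.im| = y at *
  have hp0 := norm_nonneg p
  have hq0 := norm_nonneg q
  generalize ‖p‖ = P at *
  generalize ‖q‖ = Q at *
  refine pow_le_pow_left₀ (by positivity) ?_ 2
  -- If `Q < yρ/(7R)`, then `y ≤ 2R` gives `Q ≤ 2ρ/7`, and `yP ≤ 3RQ + t` with `4t ≤ yρ` gives `P ≤
  -- (3/7 + 1/4)ρ = 19ρ/28`. This contradicts `P² + Q² = ρ²`.
  by_contra hcon
  push Not at hcon
  rw [lt_div_iff₀ (by positivity)] at hcon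
  have hy0 : 0 < y := by
    rcases hy.eq_or_lt with h0 | h0
    · rw [← h0] at hcon; nlinarith [mul_nonneg hq0 hR.le]
    · exact h0
  have hQ : Q ≤ 2 / 7 * ρ := by
    by_contra hQ
    push Not at hQ
    nlinarith [mul_le_mul_of_nonneg_right him hρ.le, mul_lt_mul_of_pos_right hQ hR]
  have hP : P ≤ 19 / 28 * ρ := by
    by_contra hP
    push Not at hP
    nlinarith [mul_lt_mul_of_pos_left hP hy0]
  nlinarith [mul_le_mul hQ hQ hq0 (by positivity), mul_le_mul hP hP hp0 (by positivity)]

/-- A minimum is at most the geometric mean. With `α` of order `1/ρ`, this replaces the critical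
power `ρ⁻²` by `ρ^{-3/2}`, to which `lintegral_rpow_neg_le` applies. -/
theorem le_sqrt_cube_of_le {m : ENNReal} {α c : ℝ} (hα : 0 ≤ α) (hc : 0 ≤ c)
    (h1 : m ≤ ENNReal.ofReal α) (h2 : m ≤ ENNReal.ofReal (α * (α * c))) :
    m ≤ ENNReal.ofReal √(α ^ 3 * c) := by
  rcases le_total 1 (α * c) with h | h
  · refine h1.trans (ENNReal.ofReal_le_ofReal (Real.le_sqrt_of_sq_le ?_))
    nlinarith [mul_le_mul_of_nonneg_left h (sq_nonneg α)]
  · refine h2.trans (ENNReal.ofReal_le_ofReal (Real.le_sqrt_of_sq_le ?_))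
    have : 0 ≤ α ^ 3 * c := by positivity
    nlinarith [mul_le_mul_of_nonneg_left h this]

/-! ### The probability that a given pair of columns is thin -/

section PairBound

variable {ν : Fin n → Fin n → Measure ℝ} {κ : ℝ}

/-- The length of the projection of column `k` of `M - z` to the plane spanned by `h₁, h₂`. -/
def projLength (z : ℂ) (h₁ h₂ : Fin n → ℂ) (k : Fin n) (u : Fin n → ℝ) : ℝ :=
  √(‖∑ i, h₁ i * (u i : ℂ) + -(z * h₁ k)‖ ^ 2 + ‖∑ i, h₂ i * (u i : ℂ) + -(z * h₂ k)‖ ^ 2)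

theorem measurable_projLength (z : ℂ) (h₁ h₂ : Fin n → ℂ) (k : Fin n) :
    Measurable (projLength z h₁ h₂ k) := by
  apply Continuous.measurable
  unfold projLength
  fun_prop

theorem pi_projLength_le {ν : Fin n → Measure ℝ} [∀ i, IsProbabilityMeasure (ν i)] (hκ : 0 ≤ κ)
    (hν : ∀ i, SmallBall (ν i) κ) {h₁ h₂ : Fin n → ℂ} (h : OrthoPair h₁ h₂) (z : ℂ) (k : Fin n)
    {r : ℝ} (hr : 0 ≤ r) :
    Measure.pi ν {u | projLength z h₁ h₂ k u ≤ r} ≤ ENNReal.ofReal (8 * κ ^ 2 * n * r ^ 2) := by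
  refine (measure_mono ?_).trans (pi_orthoPair_le hκ hν h (-(z * h₁ k)) (-(z * h₂ k)) hr)
  intro u hu
  have hu' : projLength z h₁ h₂ k u ≤ r := hu
  rw [projLength, Real.sqrt_le_left hr] at hu'
  constructor
  · refine le_of_sq_le_sq ?_ hr
    nlinarith [sq_nonneg ‖∑ i, h₂ i * (u i : ℂ) + -(z * h₂ k)‖]
  · refine le_of_sq_le_sq ?_ hr
    nlinarith [sq_nonneg ‖∑ i, h₁ i * (u i : ℂ) + -(z * h₁ k)‖]

variable [∀ j i, IsProbabilityMeasure (ν j i)]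

/-- On the thin set the area is an affine functional of column `j`, whose linear part `f` is
determined by the other columns, is almost annihilated by `M - z`, and has norm `projLength`. -/
theorem exists_functional (z : ℂ) (R t : ℝ) (x : Fin n → Fin n → ℝ) {j k : Fin n} (hjk : j ≠ k)
    {h₁ h₂ : Fin n → ℂ} (h : OrthoPair h₁ h₂)
    (hl : ∀ l, l ≠ j → l ≠ k → colPair z x h₁ l = 0 ∧ colPair z x h₂ l = 0) (u : Fin n → ℝ) :
    ∃ f : Fin n → ℂ, ∑ i, ‖f i‖ ^ 2 = projLength z h₁ h₂ k u ^ 2 ∧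
      ∀ v, Function.update (Function.update x k u) j v ∈ thinSet z R t j k →
        (∀ l, l ≠ j → colPair z (Function.update (Function.update x k u) j v) f l = 0) ∧
        ‖∑ i, f i * (v i : ℂ) + -(z * f j)‖ ≤ t := by
  set a₁ := ∑ i, h₁ i * (u i : ℂ) + -(z * h₁ k) with ha₁
  set a₂ := ∑ i, h₂ i * (u i : ℂ) + -(z * h₂ k) with ha₂
  refine ⟨fun i => a₂ * h₁ i + -a₁ * h₂ i, ?_, fun v hv => ?_⟩
  · rw [h.sum_norm_sq_comb, projLength, Real.sq_sqrt (by positivity), norm_neg, add_comm]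
  · set X := Function.update (Function.update x k u) j v with hX
    have e1 : ∀ g l, l ≠ j → l ≠ k → colPair z X g l = colPair z x g l := by
      intro g l h1 h2
      simp only [colPair, hX, Function.update_of_ne h1, Function.update_of_ne h2]
    have e2 : ∀ g, colPair z X g k = ∑ i, g i * (u i : ℂ) + -(z * g k) := by
      intro g
      simp only [colPair, hX, Function.update_of_ne hjk.symm, Function.update_self]
    have e3 : ∀ g, colPair z X g j = ∑ i, g i * (v i : ℂ) + -(z * g j) := by
      intro g
      simp only [colPair, hX, Function.update_self]
    refine ⟨fun l hlj => ?_, ?_⟩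
    · rw [colPair_comb]
      by_cases hlk : l = k
      · rw [hlk, e2, e2, ← ha₁, ← ha₂]; ring
      · rw [e1 _ _ hlj hlk, e1 _ _ hlj hlk, (hl l hlj hlk).1, (hl l hlj hlk).2]; simp
    · have h3 := hv.2 h₁ h₂ h fun l hlj hlk => by
        rw [e1 _ _ hlj hlk, e1 _ _ hlj hlk]; exact hl l hlj hlk
      rw [← e3 fun i => a₂ * h₁ i + -a₁ * h₂ i, colPair_comb]
      refine le_trans (le_of_eq ?_) h3
      rw [e2, e2, ← ha₁, ← ha₂]
      congr 1; ring

theorem pi_column_thinSet_le (hκ : 0 ≤ κ) (hν : ∀ j i, SmallBall (ν j i) κ) (z : ℂ) (R : ℝ)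
    {t : ℝ} (ht : 0 ≤ t) (x : Fin n → Fin n → ℝ) {j k : Fin n} (hjk : j ≠ k)
    {h₁ h₂ : Fin n → ℂ} (h : OrthoPair h₁ h₂)
    (hl : ∀ l, l ≠ j → l ≠ k → colPair z x h₁ l = 0 ∧ colPair z x h₂ l = 0) (u : Fin n → ℝ)
    (hu : 0 < projLength z h₁ h₂ k u) :
    Measure.pi (ν j) {v | Function.update (Function.update x k u) j v ∈ thinSet z R t j k}
      ≤ ENNReal.ofReal (2 * κ * √(n : ℝ) * t / projLength z h₁ h₂ k u) := by
  obtain ⟨f, hf, hv⟩ := exists_functional z R t x hjk h hl u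
  exact (measure_mono fun v hv' => (hv v hv').2).trans
    (pi_affine_le_of_norm hκ (hν j) f _ ht hu hf.ge)

theorem pi_column_thinSet_le_of_im (hκ : 0 < κ) (hν : ∀ j i, SmallBall (ν j i) κ) {z : ℂ} {R : ℝ}
    (hR : 0 < R) (hre : |z.re| ≤ 2 * R) (him : |z.im| ≤ 2 * R) (him0 : 0 < |z.im|)
    {t : ℝ} (ht : 0 ≤ t) (x : Fin n → Fin n → ℝ) {j k : Fin n} (hjk : j ≠ k)
    {h₁ h₂ : Fin n → ℂ} (h : OrthoPair h₁ h₂)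
    (hl : ∀ l, l ≠ j → l ≠ k → colPair z x h₁ l = 0 ∧ colPair z x h₂ l = 0) (u : Fin n → ℝ)
    (hu : 0 < projLength z h₁ h₂ k u) :
    Measure.pi (ν j) {v | Function.update (Function.update x k u) j v ∈ thinSet z R t j k}
      ≤ ENNReal.ofReal √((2 * κ * √(n : ℝ) * t / projLength z h₁ h₂ k u) ^ 3
          * ((7 * R + 2 / (κ * √(n : ℝ))) / |z.im|)) := by
  have hn : 0 < (n : ℝ) := by exact_mod_cast j.pos
  have hsn : 0 < √(n : ℝ) := Real.sqrt_pos.mpr hn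
  have h1 := pi_column_thinSet_le hκ.le hν z R ht x hjk h hl u hu
  obtain ⟨f, hf, hv⟩ := exists_functional z R t x hjk h hl u
  generalize projLength z h₁ h₂ k u = ρ at *
  set S := {v | Function.update (Function.update x k u) j v ∈ thinSet z R t j k} with hS
  refine le_sqrt_cube_of_le (by positivity) (by positivity) h1 ?_
  -- The functional `f` does not depend on column `j`, so one admissible column `v₀` is enough to
  -- show that `f` is far from real.
  rcases S.eq_empty_or_nonempty with hemp | ⟨v₀, hv₀⟩
  · rw [hemp]; simp
  rcases le_or_gt (4 * t) (|z.im| * ρ) with hcase | hcase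
  · have h2 := pi_affine_le_of_im hκ.le (hν j) f (-(z * f j)) ht hu hf.ge
      (b := |z.im| * ρ / (7 * R)) (by positivity) (fun ω hω =>
        im_sum_sq_ge hv₀.1 hR hre him (hv v₀ hv₀).1 (by
          simpa only [colPair, Function.update_self] using (hv v₀ hv₀).2) hu hf hcase hω)
    refine (measure_mono fun v hv' => (hv v hv').2).trans (h2.trans
      (ENNReal.ofReal_le_ofReal ?_))
    have h3 : 0 ≤ 2 / (κ * √(n : ℝ)) := by positivity
    calc _ = 2 * κ * √(n : ℝ) * t / ρ * (2 * κ * √(n : ℝ) * t / ρ * ((7 * R) / |z.im|)) := by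
          field_simp
      _ ≤ _ := by gcongr; linarith
  -- For large `t` the extra factor is at least one; the summand `2 / (κ √n)` is there to ensure
  -- this.
  · refine h1.trans (ENNReal.ofReal_le_ofReal (le_mul_of_one_le_right (by positivity) ?_))
    calc (1 : ℝ) ≤ 4 * t / (|z.im| * ρ) := by rw [le_div_iff₀ (by positivity)]; linarith
      _ = 2 * κ * √(n : ℝ) * t / ρ * ((2 / (κ * √(n : ℝ))) / |z.im|) := by field_simp; ring
      _ ≤ _ := by gcongr; linarith

theorem ae_projLength_pos {ν : Fin n → Measure ℝ} [∀ i, IsProbabilityMeasure (ν i)] (hκ : 0 ≤ κ)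
    (hν : ∀ i, SmallBall (ν i) κ) {h₁ h₂ : Fin n → ℂ} (h : OrthoPair h₁ h₂) (z : ℂ) (k : Fin n) :
    ∀ᵐ u ∂Measure.pi ν, 0 < projLength z h₁ h₂ k u := by
  have h0 := pi_projLength_le hκ hν h z k le_rfl
  rw [ae_iff]
  simpa using h0

/-- The probability that two given columns of `M - z` are thin. -/
theorem pi_thinSet_le (hκ : 0 < κ) (hν : ∀ j i, SmallBall (ν j i) κ) (z : ℂ) (R : ℝ)
    {t : ℝ} (ht : 0 ≤ t) {j k : Fin n} (hjk : j ≠ k) :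
    Measure.pi (fun j => Measure.pi (ν j)) (thinSet z R t j k)
      ≤ ENNReal.ofReal (12 * κ ^ 2 * n * t) := by
  have hn : 0 < (n : ℝ) := by exact_mod_cast j.pos
  refine pi_le_of_forall_two_columns (j := j) (k := k) _ (measurableSet_thinSet z R t j k) fun x => ?_
  obtain ⟨h₁, h₂, h, hl⟩ := exists_orthoPair z x hjk
  calc _ ≤ ∫⁻ u, ENNReal.ofReal (2 * κ * √(n : ℝ) * t)
          * ENNReal.ofReal (projLength z h₁ h₂ k u ^ (-1 : ℝ)) ∂Measure.pi (ν k) := by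
        refine lintegral_mono_ae ?_
        filter_upwards [ae_projLength_pos hκ.le (hν k) h z k] with u hu
        refine (pi_column_thinSet_le hκ.le hν z R ht x hjk h hl u hu).trans (le_of_eq ?_)
        rw [← ENNReal.ofReal_mul (by positivity), Real.rpow_neg_one, div_eq_mul_inv]
    _ = ENNReal.ofReal (2 * κ * √(n : ℝ) * t)
          * ∫⁻ u, ENNReal.ofReal (projLength z h₁ h₂ k u ^ (-1 : ℝ)) ∂Measure.pi (ν k) :=
        lintegral_const_mul' _ _ ENNReal.ofReal_ne_top
    _ ≤ ENNReal.ofReal (2 * κ * √(n : ℝ) * t)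
          * ENNReal.ofReal (2 / (2 - 1) * (8 * κ ^ 2 * n) ^ ((1 : ℝ) / 2)) := by
        gcongr
        exact lintegral_rpow_neg_le _ (measurable_projLength z h₁ h₂ k)
          (fun u => Real.sqrt_nonneg _) (by positivity) one_pos (by norm_num)
          fun r hr => pi_projLength_le hκ.le (hν k) h z k hr.le
    _ ≤ _ := by
        rw [← ENNReal.ofReal_mul (by positivity)]
        refine ENNReal.ofReal_le_ofReal ?_
        have h8 : (8 * κ ^ 2 * n) ^ ((1 : ℝ) / 2) ≤ 3 * κ * √(n : ℝ) := by
          rw [← Real.sqrt_eq_rpow]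
          refine Real.sqrt_le_iff.mpr ⟨by positivity, ?_⟩
          rw [mul_pow, Real.sq_sqrt hn.le, mul_pow]
          have : 0 ≤ κ ^ 2 * n := by positivity
          linarith
        calc _ ≤ 2 * κ * √(n : ℝ) * t * (2 / (2 - 1) * (3 * κ * √(n : ℝ))) := by gcongr
          _ = 12 * κ ^ 2 * √(n : ℝ) ^ 2 * t := by ring
          _ = _ := by rw [Real.sq_sqrt hn.le]

/-- The probability that two given columns of `M - z` are thin, for `z` off the real line. -/
theorem pi_thinSet_le_of_im (hκ : 0 < κ) (hν : ∀ j i, SmallBall (ν j i) κ) {z : ℂ} {R : ℝ}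
    (hR : 0 < R) (hre : |z.re| ≤ 2 * R) (him : |z.im| ≤ 2 * R) (him0 : 0 < |z.im|)
    {t : ℝ} (ht : 0 ≤ t) {j k : Fin n} (hjk : j ≠ k) :
    Measure.pi (fun j => Measure.pi (ν j)) (thinSet z R t j k)
      ≤ ENNReal.ofReal (4 * √((6 * κ ^ 2 * n * t) ^ 3
          * ((7 * R + 2 / (κ * √(n : ℝ))) / |z.im|))) := by
  have hn : 0 < (n : ℝ) := by exact_mod_cast j.pos
  set c := (7 * R + 2 / (κ * √(n : ℝ))) / |z.im| with hc
  have hc0 : 0 ≤ c := by positivity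
  refine pi_le_of_forall_two_columns (j := j) (k := k) _ (measurableSet_thinSet z R t j k) fun x => ?_
  obtain ⟨h₁, h₂, h, hl⟩ := exists_orthoPair z x hjk
  calc _ ≤ ∫⁻ u, ENNReal.ofReal √((2 * κ * √(n : ℝ) * t) ^ 3 * c)
          * ENNReal.ofReal (projLength z h₁ h₂ k u ^ (-(3 / 2) : ℝ)) ∂Measure.pi (ν k) := by
        refine lintegral_mono_ae ?_
        filter_upwards [ae_projLength_pos hκ.le (hν k) h z k] with u hu
        refine (pi_column_thinSet_le_of_im hκ hν hR hre him him0 ht x hjk h hl u hu).trans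
          (le_of_eq ?_)
        rw [← ENNReal.ofReal_mul (by positivity)]
        congr 1
        generalize projLength z h₁ h₂ k u = ρ at *
        rw [div_pow, div_mul_eq_mul_div, Real.sqrt_div (by positivity), Real.rpow_neg hu.le,
          div_eq_mul_inv, Real.sqrt_eq_rpow (ρ ^ 3), ← Real.rpow_natCast ρ 3, ← Real.rpow_mul hu.le, ← hc]
        norm_num
    _ = ENNReal.ofReal √((2 * κ * √(n : ℝ) * t) ^ 3 * c)
          * ∫⁻ u, ENNReal.ofReal (projLength z h₁ h₂ k u ^ (-(3 / 2) : ℝ)) ∂Measure.pi (ν k) :=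
        lintegral_const_mul' _ _ ENNReal.ofReal_ne_top
    _ ≤ ENNReal.ofReal √((2 * κ * √(n : ℝ) * t) ^ 3 * c)
          * ENNReal.ofReal (2 / (2 - 3 / 2) * (8 * κ ^ 2 * n) ^ ((3 / 2 : ℝ) / 2)) := by
        gcongr
        exact lintegral_rpow_neg_le _ (measurable_projLength z h₁ h₂ k)
          (fun u => Real.sqrt_nonneg _) (by positivity) (by norm_num) (by norm_num)
          fun r hr => pi_projLength_le hκ.le (hν k) h z k hr.le
    _ ≤ _ := by
        rw [← ENNReal.ofReal_mul (by positivity)]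
        refine ENNReal.ofReal_le_ofReal ?_
        have h8 : (8 * κ ^ 2 * n) ^ ((3 / 2 : ℝ) / 2) ≤ √((3 * κ * √(n : ℝ)) ^ 3) := by
          have : (3 * κ * √(n : ℝ)) ^ 3 = ((3 * κ * √(n : ℝ)) ^ 2) ^ (3 / 2 : ℝ) := by
            rw [← Real.rpow_natCast _ 2, ← Real.rpow_natCast _ 3,
              ← Real.rpow_mul (by positivity)]
            norm_num
          rw [this, Real.sqrt_eq_rpow, ← Real.rpow_mul (by positivity)]
          rw [show (3 / 2 : ℝ) / 2 = 3 / 2 * (1 / 2) by norm_num]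
          refine Real.rpow_le_rpow (by positivity) ?_ (by norm_num)
          rw [mul_pow, Real.sq_sqrt hn.le, mul_pow]
          have : 0 ≤ κ ^ 2 * n := by positivity
          linarith
        calc _ ≤ √((2 * κ * √(n : ℝ) * t) ^ 3 * c)
              * (2 / (2 - 3 / 2) * √((3 * κ * √(n : ℝ)) ^ 3)) := by gcongr
          _ = 4 * (√((2 * κ * √(n : ℝ) * t) ^ 3 * c) * √((3 * κ * √(n : ℝ)) ^ 3)) := by ring
          _ = 4 * √((6 * κ ^ 2 * √(n : ℝ) ^ 2 * t) ^ 3 * c) := by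
              rw [← Real.sqrt_mul (by positivity)]
              congr 2; ring
          _ = _ := by rw [Real.sq_sqrt hn.le]

end PairBound

/-! ### From two eigenvalues near a point to a thin pair of columns -/

/-- Two eigenvalues, listed with multiplicity, give two vectors in triangular position. -/
theorem exists_triangular_pair {V : Type*} [AddCommGroup V] [Module ℂ V] [FiniteDimensional ℂ V]
    (T : Module.End ℂ V) {a b : ℂ} (h : ({a, b} : Multiset ℂ) ≤ T.charpoly.roots) :
    ∃ v w : V, v ≠ 0 ∧ w ∉ Submodule.span ℂ {v} ∧ T v = a • v ∧ ∃ c : ℂ, T w = b • w + c • v := by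
  have hroot : ∀ d ∈ T.charpoly.roots, ∃ v : V, v ≠ 0 ∧ T v = d • v := by
    intro d hd
    have h1 : T.HasEigenvalue d :=
      (Module.End.hasEigenvalue_iff_isRoot_charpoly T d).mpr (Polynomial.isRoot_of_mem_roots hd)
    obtain ⟨v, hv⟩ := h1.exists_hasEigenvector
    exact ⟨v, hv.2, hv.apply_eq_smul⟩
  obtain ⟨v, hv0, hv⟩ := hroot a (Multiset.mem_of_le h (by simp))
  by_cases hab : a = b
  · subst hab
    have hcount : 2 ≤ T.charpoly.rootMultiplicity a := by
      rw [← Polynomial.count_roots]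
      have := Multiset.count_le_of_le a h
      simpa using this
    rw [← LinearMap.finrank_maxGenEigenspace_eq] at hcount
    obtain ⟨w, hw, hwv⟩ : ∃ w ∈ T.maxGenEigenspace a, w ∉ Submodule.span ℂ {v} := by
      by_contra hcon
      push Not at hcon
      have h1 := Submodule.finrank_mono (R := ℂ) (M := V) (s := T.maxGenEigenspace a) hcon
      rw [finrank_span_singleton hv0] at h1
      omega
    obtain ⟨m, hm⟩ := (Module.End.mem_maxGenEigenspace T a w).mp hw
    classical
    -- The last iterate of `w` under `T - a` still outside the line of `v` is the required vector,
    -- since one more application lands in that line.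
    have hex : ∃ m, ((T - a • (1 : Module.End ℂ V)) ^ m) w ∈ Submodule.span ℂ {v} :=
      ⟨m, by rw [hm]; exact Submodule.zero_mem _⟩
    have hmin := fun i => Nat.find_min (m := i) hex
    have hspec := Nat.find_spec hex
    obtain ⟨i, hi⟩ : ∃ i, Nat.find hex = i + 1 := by
      refine Nat.exists_eq_succ_of_ne_zero fun h0 => hwv ?_
      rw [h0] at hspec
      simpa using hspec
    rw [hi] at hspec hmin
    refine ⟨v, _, hv0, hmin i (Nat.lt_succ_self i), hv, ?_⟩
    rw [pow_succ'] at hspec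
    obtain ⟨c, hc⟩ := Submodule.mem_span_singleton.mp hspec
    refine ⟨c, ?_⟩
    rw [hc]
    simp
  · obtain ⟨w, hw0, hw⟩ := hroot b (Multiset.mem_of_le h (by simp))
    refine ⟨v, w, hv0, fun hmem => ?_, hv, 0, by simpa using hw⟩
    obtain ⟨c, rfl⟩ := Submodule.mem_span_singleton.mp hmem
    rw [map_smul, hv, smul_comm, ← sub_eq_zero, ← sub_smul] at hw
    rcases smul_eq_zero.mp hw with h1 | h1
    · exact hab (sub_eq_zero.mp h1)
    · exact hw0 h1

theorem orthoPair_of_inner_eq_zero {v w : EuclideanSpace ℂ (Fin n)} (hv : ‖v‖ = 1) (hw : ‖w‖ = 1)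
    (h : inner ℂ v w = 0) : OrthoPair v w := by
  refine ⟨by rw [← EuclideanSpace.norm_sq_eq, hv, one_pow],
    by rw [← EuclideanSpace.norm_sq_eq, hw, one_pow], ?_⟩
  rw [← h, PiLp.inner_apply]
  exact Finset.sum_congr rfl fun i _ => by rw [RCLike.inner_apply, mul_comm]

/-- The orthonormal version of `exists_triangular_pair`. -/
theorem exists_orthoPair_triangular (M : Matrix (Fin n) (Fin n) ℂ) {a b : ℂ}
    (h : ({a, b} : Multiset ℂ) ≤ M.charpoly.roots) :
    ∃ v w : Fin n → ℂ, OrthoPair v w ∧ M.mulVec v = a • v ∧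
      ∃ c : ℂ, M.mulVec w = b • w + c • v := by
  rw [← Matrix.charpoly_toLin'] at h
  obtain ⟨v, w, hv0, hwv, hv, c, hw⟩ := exists_triangular_pair _ h
  rw [Matrix.toLin'_apply] at hv hw
  let v' : EuclideanSpace ℂ (Fin n) := WithLp.toLp 2 v
  let w' : EuclideanSpace ℂ (Fin n) := WithLp.toLp 2 w
  have hv'0 : v' ≠ 0 := fun h0 => hv0 (by simpa [v'] using h0)
  let d : ℂ := inner ℂ v' w' / (‖v'‖ : ℂ) ^ 2
  let u' : EuclideanSpace ℂ (Fin n) := w' - d • v'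
  have hu'0 : u' ≠ 0 := fun h0 => hwv (by
    have h1 : w = d • v := by
      have := congrArg WithLp.ofLp (sub_eq_zero.mp h0)
      simpa [v', w'] using this
    rw [h1]
    exact Submodule.smul_mem _ _ (Submodule.mem_span_singleton_self v))
  have hnv : (‖v'‖ : ℂ) ≠ 0 := by exact_mod_cast norm_ne_zero_iff.mpr hv'0
  have hinner : inner ℂ v' u' = 0 := by
    simp only [u', inner_sub_right, inner_smul_right, inner_self_eq_norm_sq_to_K, d]
    simp only [Complex.coe_algebraMap]
    field_simp
    simp
  refine ⟨((‖v'‖ : ℂ)⁻¹ • v' : EuclideanSpace ℂ (Fin n)),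
    ((‖u'‖ : ℂ)⁻¹ • u' : EuclideanSpace ℂ (Fin n)), orthoPair_of_inner_eq_zero ?_ ?_ ?_, ?_, ?_⟩
  · rw [norm_smul, norm_inv, Complex.norm_real, norm_norm,
      inv_mul_cancel₀ (norm_ne_zero_iff.mpr hv'0)]
  · rw [norm_smul, norm_inv, Complex.norm_real, norm_norm,
      inv_mul_cancel₀ (norm_ne_zero_iff.mpr hu'0)]
  · rw [inner_smul_left, inner_smul_right, hinner]; simp
  · change M.mulVec ((‖v'‖ : ℂ)⁻¹ • v) = a • ((‖v'‖ : ℂ)⁻¹ • v)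
    rw [Matrix.mulVec_smul, hv, smul_comm]
  · refine ⟨(‖u'‖ : ℂ)⁻¹ * (c + d * b - d * a) * ‖v'‖, ?_⟩
    change M.mulVec ((‖u'‖ : ℂ)⁻¹ • (w - d • v)) = b • ((‖u'‖ : ℂ)⁻¹ • (w - d • v))
      + ((‖u'‖ : ℂ)⁻¹ * (c + d * b - d * a) * ‖v'‖) • ((‖v'‖ : ℂ)⁻¹ • v)
    rw [Matrix.mulVec_smul, Matrix.mulVec_sub, Matrix.mulVec_smul, hv, hw,
      smul_smul _ ((‖v'‖ : ℂ)⁻¹) v, mul_assoc _ (‖v'‖ : ℂ), mul_inv_cancel₀ hnv]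
    module

/-- The matrix with columns `x`. -/
def colMatrix (x : Fin n → Fin n → ℝ) : Matrix (Fin n) (Fin n) ℝ := Matrix.of fun i j => x j i

theorem sum_colPair_mul (z : ℂ) (x : Fin n → Fin n → ℝ) (h v : Fin n → ℂ) :
    ∑ l, colPair z x h l * v l
      = ∑ i, h i * (((colMatrix x).map (algebraMap ℝ ℂ)).mulVec v) i - z * ∑ i, h i * v i := by
  simp only [colPair, add_mul, Finset.sum_add_distrib, Finset.sum_mul, Matrix.mulVec, dotProduct,
    Finset.mul_sum, colMatrix, Matrix.map_apply, Matrix.of_apply]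
  rw [Finset.sum_comm, sub_eq_add_neg, ← Finset.sum_neg_distrib]
  congr 1
  · refine Finset.sum_congr rfl fun i _ => Finset.sum_congr rfl fun l _ => ?_
    simp only [Complex.coe_algebraMap]; ring
  · exact Finset.sum_congr rfl fun i _ => by ring

theorem norm_sum_mul_le_one {h v : Fin n → ℂ} (hh : ∑ i, ‖h i‖ ^ 2 = 1) (hv : ∑ i, ‖v i‖ ^ 2 = 1) :
    ‖∑ i, h i * v i‖ ≤ 1 := by
  calc ‖∑ i, h i * v i‖ ≤ ∑ i, (‖h i‖ ^ 2 / 2 + ‖v i‖ ^ 2 / 2) := by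
        refine (norm_sum_le _ _).trans (Finset.sum_le_sum fun i _ => ?_)
        rw [norm_mul]
        nlinarith [sq_nonneg (‖h i‖ - ‖v i‖)]
    _ = 1 := by
        rw [Finset.sum_add_distrib, ← Finset.sum_div, ← Finset.sum_div, hh, hv]; norm_num

theorem sum_mul_eq_two {j k : Fin n} (hjk : j ≠ k) {f g : Fin n → ℂ}
    (hf : ∀ l, l ≠ j → l ≠ k → f l = 0) : ∑ l, f l * g l = f j * g j + f k * g k := by
  rw [← Finset.sum_subset (Finset.subset_univ {j, k}), Finset.sum_pair hjk]
  intro l _ hl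
  simp only [Finset.mem_insert, Finset.mem_singleton, not_or] at hl
  rw [hf l hl.1 hl.2, zero_mul]

/-- The coordinate `(j, k)` of `v ∧ w`, times the area spanned by the columns `j, k` modulo the
other columns, is bounded by the product of the two eigenvalues. -/
theorem norm_area_mul_le {z a b c : ℂ} {x : Fin n → Fin n → ℝ} {v w h₁ h₂ : Fin n → ℂ}
    (hvw : OrthoPair v w) (hv : ((colMatrix x).map (algebraMap ℝ ℂ)).mulVec v = a • v)
    (hw : ((colMatrix x).map (algebraMap ℝ ℂ)).mulVec w = b • w + c • v) {j k : Fin n}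
    (hjk : j ≠ k) (h : OrthoPair h₁ h₂)
    (hl : ∀ l, l ≠ j → l ≠ k → colPair z x h₁ l = 0 ∧ colPair z x h₂ l = 0) :
    ‖colPair z x h₁ j * colPair z x h₂ k - colPair z x h₁ k * colPair z x h₂ j‖
      * ‖v j * w k - w j * v k‖ ≤ 2 * (‖a - z‖ * ‖b - z‖) := by
  -- Both sides evaluate `g (M - z)` on `v` and on `w`: once through the columns, of which only `j`
  -- and `k` contribute, and once through the triangular form.
  have key : ∀ g : Fin n → ℂ, (∀ l, l ≠ j → l ≠ k → colPair z x g l = 0) →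
      colPair z x g j * v j + colPair z x g k * v k = (a - z) * ∑ i, g i * v i ∧
      colPair z x g j * w j + colPair z x g k * w k
        = (b - z) * ∑ i, g i * w i + c * ∑ i, g i * v i := by
    intro g hg
    rw [← sum_mul_eq_two hjk hg, ← sum_mul_eq_two hjk hg, sum_colPair_mul, sum_colPair_mul, hv, hw]
    have hs : ∀ (d : ℂ) (q : Fin n → ℂ), ∑ i, g i * (d * q i) = d * ∑ i, g i * q i := by
      intro d q
      rw [Finset.mul_sum]
      exact Finset.sum_congr rfl fun i _ => by ring
    simp only [Pi.smul_apply, Pi.add_apply, smul_eq_mul, mul_add, Finset.sum_add_distrib, hs]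
    constructor <;> ring
  obtain ⟨k1, k2⟩ := key h₁ fun l h1 h2 => (hl l h1 h2).1
  obtain ⟨k3, k4⟩ := key h₂ fun l h1 h2 => (hl l h1 h2).2
  set p₁ := ∑ i, h₁ i * v i
  set p₂ := ∑ i, h₁ i * w i
  set p₃ := ∑ i, h₂ i * v i
  set p₄ := ∑ i, h₂ i * w i
  -- Determinants of an identity of products of `2 × 2` matrices; the triangular factor has
  -- determinant `(a - z)(b - z)`, so `c` drops out.
  have hdet : (colPair z x h₁ j * colPair z x h₂ k - colPair z x h₁ k * colPair z x h₂ j)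
      * (v j * w k - w j * v k) = (a - z) * (b - z) * (p₁ * p₄ - p₂ * p₃) := by
    linear_combination (colPair z x h₂ j * w j + colPair z x h₂ k * w k) * k1
      + (a - z) * p₁ * k4 - (colPair z x h₂ j * v j + colPair z x h₂ k * v k) * k2
      - ((b - z) * p₂ + c * p₁) * k3
  rw [← norm_mul, hdet, norm_mul, norm_mul, mul_comm]
  refine mul_le_mul_of_nonneg_right ?_ (by positivity)
  have b1 : ‖p₁‖ ≤ 1 := norm_sum_mul_le_one h.1 hvw.1
  have b2 : ‖p₂‖ ≤ 1 := norm_sum_mul_le_one h.1 hvw.2.1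
  have b3 : ‖p₃‖ ≤ 1 := norm_sum_mul_le_one h.2.1 hvw.1
  have b4 : ‖p₄‖ ≤ 1 := norm_sum_mul_le_one h.2.1 hvw.2.1
  refine (norm_sub_le _ _).trans ?_
  rw [norm_mul, norm_mul]
  have := mul_le_mul b1 b4 (norm_nonneg _) zero_le_one
  have := mul_le_mul b2 b3 (norm_nonneg _) zero_le_one
  linarith

/-- The bivector `v ∧ w` has norm one; ordered pairs count each coordinate twice. -/
theorem OrthoPair.sum_sum_norm_sq {v w : Fin n → ℂ} (h : OrthoPair v w) :
    ∑ j, ∑ k, ‖v j * w k - w j * v k‖ ^ 2 = 2 := by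
  have : ∀ j, ∑ k, ‖v j * w k - w j * v k‖ ^ 2 = ‖w j‖ ^ 2 + ‖v j‖ ^ 2 := by
    intro j
    rw [← norm_neg (w j), ← h.sum_norm_sq_comb]
    refine Finset.sum_congr rfl fun k _ => ?_
    congr 2; ring
  simp_rw [this, Finset.sum_add_distrib]
  rw [h.1, h.2.1]; norm_num

/-- Matrices of norm at most `R` with two eigenvalues close to `z`. -/
def closePairSet (z : ℂ) (R τ : ℝ) : Set (Fin n → Fin n → ℝ) :=
  {x | NormLe R x ∧ ∃ a b : ℂ, ({a, b} : Multiset ℂ) ≤ eigenvalues (colMatrix x) ∧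
    ‖a - z‖ * ‖b - z‖ ≤ τ}

/-- Weighting the pairs by `|(v ∧ w)_{jk}|²` instead of picking the largest coordinate loses no
power of `n` in the thinness level. Large levels carry small weights. -/
theorem one_le_sum_indicator_of_mem_closePairSet {z : ℂ} {R τ : ℝ}
    {x : Fin n → Fin n → ℝ} (hx : x ∈ closePairSet z R τ) :
    1 ≤ ∑ j, ∑ k, ∑' m : ℕ, if j = k then 0 else ENNReal.ofReal (2 * (1 / 4) ^ m)
      * (thinSet z R (2 * τ * 2 ^ m) j k).indicator 1 x := by
  obtain ⟨hR, a, b, hab, hτ⟩ := hx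
  obtain ⟨v, w, hvw, hv, c, hw⟩ := exists_orthoPair_triangular _ hab
  have hsum := hvw.sum_sum_norm_sq
  have hterm : ∀ j k, ENNReal.ofReal (‖v j * w k - w j * v k‖ ^ 2 / 2) ≤
      ∑' m : ℕ, if j = k then 0 else ENNReal.ofReal (2 * (1 / 4) ^ m)
        * (thinSet z R (2 * τ * 2 ^ m) j k).indicator 1 x := by
    intro j k
    by_cases hjk : j = k
    · subst hjk; simp [mul_comm]
    simp only [hjk, if_false]
    set W := ‖v j * w k - w j * v k‖ with hW
    rcases (norm_nonneg (v j * w k - w j * v k)).eq_or_lt with h0 | h0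
    · rw [← hW] at h0; simp [← h0]
    rw [← hW] at h0
    have hW2 : W ^ 2 ≤ 2 := by
      rw [← hsum]
      refine (Finset.single_le_sum (f := fun k => ‖v j * w k - w j * v k‖ ^ 2)
        (fun i _ => by positivity) (Finset.mem_univ k)).trans
        (Finset.single_le_sum (f := fun j => ∑ k, ‖v j * w k - w j * v k‖ ^ 2)
        (fun i _ => by positivity) (Finset.mem_univ j))
    have hW1 : W / 2 ≤ 1 := by nlinarith
    -- The dyadic scale of `W`: `2^{-m} < W ≤ 2 · 2^{-m}`. The lower bound gives thinness at level
    -- `2τ 2^m`, the upper one the weight `2 · 4^{-m}`.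
    obtain ⟨m, hm1, hm2⟩ := exists_nat_pow_near_of_lt_one (x := W / 2) (y := 1 / 2)
      (by positivity) hW1 (by norm_num) (by norm_num)
    have hmem : x ∈ thinSet z R (2 * τ * 2 ^ m) j k := by
      refine ⟨hR, fun h₁ h₂ h hl => ?_⟩
      have h1 := norm_area_mul_le hvw hv hw hjk h hl
      rw [← hW] at h1
      have h2 : 1 ≤ W * 2 ^ m := by
        rw [pow_succ, one_div_pow] at hm1
        have : (1 : ℝ) / 2 ^ m ≤ W := by linarith
        rwa [div_le_iff₀ (by positivity)] at this
      set D := ‖colPair z x h₁ j * colPair z x h₂ k - colPair z x h₁ k * colPair z x h₂ j‖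
      have hD : 0 ≤ D := norm_nonneg _
      calc D ≤ D * (W * 2 ^ m) := le_mul_of_one_le_right hD h2
        _ = (D * W) * 2 ^ m := by ring
        _ ≤ 2 * τ * 2 ^ m := mul_le_mul_of_nonneg_right (by linarith) (by positivity)
    refine le_trans ?_ (ENNReal.le_tsum m)
    rw [Set.indicator_of_mem hmem, Pi.one_apply, mul_one]
    refine ENNReal.ofReal_le_ofReal ?_
    have h3 : W ≤ 2 * (1 / 2) ^ m := by linarith
    calc W ^ 2 / 2 ≤ (2 * (1 / 2) ^ m) ^ 2 / 2 := by gcongr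
      _ = 2 * ((1 / 2) ^ 2) ^ m := by rw [mul_pow, ← pow_mul, ← pow_mul, mul_comm m 2]; ring
      _ = _ := by norm_num
  calc (1 : ENNReal) = ENNReal.ofReal (∑ j, ∑ k, ‖v j * w k - w j * v k‖ ^ 2 / 2) := by
        simp_rw [← Finset.sum_div]
        rw [hsum]; norm_num
    _ = ∑ j, ∑ k, ENNReal.ofReal (‖v j * w k - w j * v k‖ ^ 2 / 2) := by
        rw [ENNReal.ofReal_sum_of_nonneg fun _ _ => by positivity]
        refine Finset.sum_congr rfl fun j _ => ?_
        rw [ENNReal.ofReal_sum_of_nonneg fun _ _ => by positivity]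
    _ ≤ _ := Finset.sum_le_sum fun j _ => Finset.sum_le_sum fun k _ => hterm j k

/-! ### The probability of two eigenvalues near a fixed point -/

theorem measure_closePairSet_le (μ : Measure (Fin n → Fin n → ℝ)) (z : ℂ) (R τ : ℝ)
    (b : ℕ → ENNReal) (hb : ∀ m j k, j ≠ k → μ (thinSet z R (2 * τ * 2 ^ m) j k) ≤ b m) :
    μ (closePairSet z R τ) ≤ (n : ENNReal) ^ 2 * ∑' m, ENNReal.ofReal (2 * (1 / 4) ^ m) * b m := by
  let F : (Fin n → Fin n → ℝ) → ENNReal := fun x =>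
    ∑ j, ∑ k, ∑' m : ℕ, if j = k then 0 else ENNReal.ofReal (2 * (1 / 4) ^ m)
      * (thinSet z R (2 * τ * 2 ^ m) j k).indicator 1 x
  have hmeas : ∀ (j k : Fin n) (m : ℕ), Measurable fun x => if j = k then (0 : ENNReal) else
      ENNReal.ofReal (2 * (1 / 4) ^ m) * (thinSet z R (2 * τ * 2 ^ m) j k).indicator 1 x := by
    intro j k m
    by_cases hjk : j = k
    · simp [hjk]
    · simp only [hjk, if_false]
      exact (measurable_one.indicator (measurableSet_thinSet z R _ j k)).const_mul _
  have hF : Measurable F := by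
    refine Finset.measurable_fun_sum _ fun j _ => Finset.measurable_fun_sum _ fun k _ => ?_
    exact Measurable.tsum fun m => hmeas j k m
  calc μ (closePairSet z R τ) ≤ μ {x | 1 ≤ F x} :=
        measure_mono fun x hx => one_le_sum_indicator_of_mem_closePairSet hx
    -- Markov's inequality for the measurable majorant `F`; measurability of `closePairSet` is not
    -- needed.
    _ ≤ ∫⁻ x, F x ∂μ := by
        have := mul_meas_ge_le_lintegral (μ := μ) hF 1
        simpa using this
    _ = ∑ j, ∑ k, ∑' m, ∫⁻ x, (if j = k then (0 : ENNReal) else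
          ENNReal.ofReal (2 * (1 / 4) ^ m) * (thinSet z R (2 * τ * 2 ^ m) j k).indicator 1 x) ∂μ := by
        rw [lintegral_finsetSum _ fun j _ => Finset.measurable_fun_sum _ fun k _ =>
          Measurable.tsum fun m => hmeas j k m]
        refine Finset.sum_congr rfl fun j _ => ?_
        rw [lintegral_finsetSum _ fun k _ => Measurable.tsum fun m => hmeas j k m]
        refine Finset.sum_congr rfl fun k _ => ?_
        exact lintegral_tsum fun m => (hmeas j k m).aemeasurable
    _ ≤ ∑ _j : Fin n, ∑ _k : Fin n, ∑' m, ENNReal.ofReal (2 * (1 / 4) ^ m) * b m := by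
        refine Finset.sum_le_sum fun j _ => Finset.sum_le_sum fun k _ =>
          ENNReal.tsum_le_tsum fun m => ?_
        by_cases hjk : j = k
        · simp [hjk]
        · simp only [hjk, if_false]
          rw [lintegral_const_mul _ (measurable_one.indicator (measurableSet_thinSet z R _ j k)),
            lintegral_indicator_one (measurableSet_thinSet z R _ j k)]
          gcongr
          exact hb m j k hjk
    _ = _ := by
        simp only [Finset.sum_const, Finset.card_univ, Fintype.card_fin, nsmul_eq_mul]
        ring

theorem tsum_ofReal_geometric (a : ℝ) {r : ℝ} (ha : 0 ≤ a) (hr : 0 ≤ r) (hr1 : r < 1) :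
    ∑' m : ℕ, ENNReal.ofReal (a * r ^ m) = ENNReal.ofReal (a * (1 - r)⁻¹) := by
  rw [← ENNReal.ofReal_tsum_of_nonneg (fun m => by positivity)
    ((summable_geometric_of_lt_one hr hr1).mul_left a), tsum_mul_left,
    tsum_geometric_of_lt_one hr hr1]

section

variable {ν : Fin n → Fin n → Measure ℝ} {κ : ℝ} [∀ j i, IsProbabilityMeasure (ν j i)]

theorem pi_closePairSet_le (hκ : 0 < κ) (hν : ∀ j i, SmallBall (ν j i) κ) (z : ℂ) (R : ℝ)
    {τ : ℝ} (hτ : 0 ≤ τ) :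
    Measure.pi (fun j => Measure.pi (ν j)) (closePairSet z R τ)
      ≤ ENNReal.ofReal (96 * κ ^ 2 * n ^ 3 * τ) := by
  refine (measure_closePairSet_le _ z R τ
    (fun m => ENNReal.ofReal (12 * κ ^ 2 * n * (2 * τ * 2 ^ m)))
    fun m j k hjk => pi_thinSet_le hκ hν z R (by positivity) hjk).trans ?_
  have h1 : ∀ m : ℕ, ENNReal.ofReal (2 * (1 / 4) ^ m)
      * ENNReal.ofReal (12 * κ ^ 2 * n * (2 * τ * 2 ^ m))
      = ENNReal.ofReal (48 * κ ^ 2 * n * τ * (1 / 2) ^ m) := by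
    intro m
    rw [← ENNReal.ofReal_mul (by positivity)]
    congr 1
    rw [show (1 / 2 : ℝ) = 1 / 4 * 2 by norm_num, mul_pow]; ring
  simp_rw [h1]
  rw [tsum_ofReal_geometric _ (by positivity) (by norm_num) (by norm_num),
    show (n : ENNReal) ^ 2 = ENNReal.ofReal ((n : ℝ) ^ 2) by
      rw [ENNReal.ofReal_pow (by positivity), ENNReal.ofReal_natCast],
    ← ENNReal.ofReal_mul (by positivity)]
  refine ENNReal.ofReal_le_ofReal (le_of_eq ?_)
  norm_num; ring

theorem pi_closePairSet_le_of_im (hκ : 0 < κ) (hν : ∀ j i, SmallBall (ν j i) κ) {z : ℂ} {R : ℝ}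
    (hR : 0 < R) (hre : |z.re| ≤ 2 * R) (him : |z.im| ≤ 2 * R) (him0 : 0 < |z.im|)
    {τ : ℝ} (hτ : 0 ≤ τ) :
    Measure.pi (fun j => Measure.pi (ν j)) (closePairSet z R τ)
      ≤ ENNReal.ofReal (32 * n ^ 2 * √((12 * κ ^ 2 * n * τ) ^ 3
          * ((7 * R + 2 / (κ * √(n : ℝ))) / |z.im|))) := by
  set c := (7 * R + 2 / (κ * √(n : ℝ))) / |z.im| with hc
  have hc0 : 0 ≤ c := by positivity
  refine (measure_closePairSet_le _ z R τ
    (fun m => ENNReal.ofReal (4 * √((6 * κ ^ 2 * n * (2 * τ * 2 ^ m)) ^ 3 * c)))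
    fun m j k hjk => pi_thinSet_le_of_im hκ hν hR hre him him0 (by positivity) hjk).trans ?_
  have h1 : ∀ m : ℕ, ENNReal.ofReal (2 * (1 / 4) ^ m)
      * ENNReal.ofReal (4 * √((6 * κ ^ 2 * n * (2 * τ * 2 ^ m)) ^ 3 * c))
      ≤ ENNReal.ofReal (8 * √((12 * κ ^ 2 * n * τ) ^ 3 * c) * (3 / 4) ^ m) := by
    intro m
    rw [← ENNReal.ofReal_mul (by positivity)]
    refine ENNReal.ofReal_le_ofReal ?_
    -- The growth `2^{3m/2}` is rounded up to `3^m`, which the weights `4^{-m}` still beat.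
    have h2 : √((6 * κ ^ 2 * n * (2 * τ * 2 ^ m)) ^ 3 * c)
        ≤ √((12 * κ ^ 2 * n * τ) ^ 3 * c) * 3 ^ m := by
      rw [Real.sqrt_le_iff]
      refine ⟨by positivity, ?_⟩
      rw [mul_pow _ ((3 : ℝ) ^ m), Real.sq_sqrt (by positivity)]
      calc (6 * κ ^ 2 * n * (2 * τ * 2 ^ m)) ^ 3 * c
          = (12 * κ ^ 2 * n * τ) ^ 3 * c * ((2 : ℝ) ^ 3) ^ m := by
            rw [← pow_mul, mul_comm 3 m, pow_mul]; ring
        _ ≤ (12 * κ ^ 2 * n * τ) ^ 3 * c * ((3 : ℝ) ^ 2) ^ m := by gcongr; norm_num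
        _ = _ := by rw [← pow_mul, mul_comm 2 m, pow_mul]
    calc _ ≤ 2 * (1 / 4) ^ m * (4 * (√((12 * κ ^ 2 * n * τ) ^ 3 * c) * 3 ^ m)) := by gcongr
      _ = _ := by rw [show (3 / 4 : ℝ) = 1 / 4 * 3 by norm_num, mul_pow (1 / 4 : ℝ)]; ring
  refine (mul_le_mul_right (ENNReal.tsum_le_tsum h1) _).trans ?_
  rw [tsum_ofReal_geometric _ (by positivity) (by norm_num) (by norm_num),
    show (n : ENNReal) ^ 2 = ENNReal.ofReal ((n : ℝ) ^ 2) by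
      rw [ENNReal.ofReal_pow (by positivity), ENNReal.ofReal_natCast],
    ← ENNReal.ofReal_mul (by positivity)]
  refine ENNReal.ofReal_le_ofReal (le_of_eq ?_)
  norm_num; ring

end

/-! ### The net and the union bound -/

/-- Matrices of norm at most `R` with two eigenvalues at distance at most `2s`. -/
def gapSet (R s : ℝ) : Set (Fin n → Fin n → ℝ) :=
  {x | NormLe R x ∧ ∃ a b : ℂ, ({a, b} : Multiset ℂ) ≤ eigenvalues (colMatrix x) ∧
    ‖a‖ ≤ R ∧ ‖a - b‖ ≤ 2 * s}

/-- The sign of a real number, given by a Boolean. -/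
def boolSign (σ : Bool) : ℝ := if σ then 1 else -1

theorem abs_boolSign (σ : Bool) : |boolSign σ| = 1 := by cases σ <;> simp [boolSign]

/-- The points of a net of the complex plane of mesh `s`. -/
def netPoint (s : ℝ) (q : Bool × Bool × ℕ × ℕ) : ℂ :=
  ⟨boolSign q.1 * (q.2.2.1 * s), boolSign q.2.1 * (q.2.2.2 * s)⟩

theorem exists_near_mul {s R a : ℝ} (hs : 0 < s) (ha : |a| ≤ R) :
    ∃ (σ : Bool) (k : ℕ), k < ⌊R / s⌋₊ + 1 ∧ |a - boolSign σ * (k * s)| ≤ s := by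
  have key : ∀ b : ℝ, 0 ≤ b → |b - (⌊b / s⌋₊ : ℝ) * s| ≤ s := by
    intro b hb
    have h1 := Nat.floor_le (div_nonneg hb hs.le)
    have h2 := Nat.lt_floor_add_one (b / s)
    rw [le_div_iff₀ hs] at h1
    rw [div_lt_iff₀ hs] at h2
    rw [abs_le]
    constructor <;> nlinarith
  have hk : ⌊|a| / s⌋₊ < ⌊R / s⌋₊ + 1 :=
    Nat.lt_succ_of_le (Nat.floor_le_floor (by gcongr))
  rcases le_total 0 a with h | h
  · refine ⟨true, _, hk, ?_⟩
    rw [abs_of_nonneg h]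
    simpa [boolSign] using key a h
  · refine ⟨false, _, hk, ?_⟩
    rw [abs_of_nonpos h]
    have := key (-a) (by linarith)
    rw [← abs_neg]
    simp only [boolSign]
    convert this using 2
    simp; ring

theorem gapSet_subset {R s : ℝ} (hs : 0 < s) :
    gapSet (n := n) R s ⊆ ⋃ q ∈ (Finset.univ : Finset Bool) ×ˢ (Finset.univ : Finset Bool) ×ˢ
      Finset.range (⌊R / s⌋₊ + 1) ×ˢ Finset.range (⌊R / s⌋₊ + 1),
      closePairSet (netPoint s q) R (8 * s ^ 2) := by
  rintro x ⟨hx, a, b, hab, ha, hgap⟩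
  obtain ⟨σ, k, hk, h1⟩ := exists_near_mul hs ((Complex.abs_re_le_norm a).trans ha)
  obtain ⟨σ', m, hm, h2⟩ := exists_near_mul hs ((Complex.abs_im_le_norm a).trans ha)
  refine Set.mem_iUnion₂.mpr ⟨(σ, σ', k, m), ?_, hx, a, b, hab, ?_⟩
  · simp only [Finset.mem_product, Finset.mem_univ, Finset.mem_range, true_and]
    exact ⟨hk, hm⟩
  · have h3 : ‖a - netPoint s (σ, σ', k, m)‖ ≤ 2 * s := by
      refine (Complex.norm_le_abs_re_add_abs_im _).trans ?_
      simp only [netPoint, Complex.sub_re, Complex.sub_im]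
      linarith
    have h4 : ‖b - netPoint s (σ, σ', k, m)‖ ≤ 4 * s := by
      have : b - netPoint s (σ, σ', k, m) = (a - netPoint s (σ, σ', k, m)) - (a - b) := by ring
      rw [this]
      refine (norm_sub_le _ _).trans ?_
      linarith
    calc _ ≤ (2 * s) * (4 * s) := mul_le_mul h3 h4 (norm_nonneg _) (by positivity)
      _ = _ := by ring

/-- The term `m = 0` is zero, as `1 / 0 = 0`; it stands for the net points on the real axis, which
are bounded separately. -/
theorem sum_one_div_sqrt_le (L : ℕ) : ∑ m ∈ Finset.range (L + 1), 1 / √(m : ℝ) ≤ 2 * √(L : ℝ) := by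
  induction L with
  | zero => simp
  | succ L ih =>
    rw [Finset.sum_range_succ]
    refine (add_le_add_left ih _).trans ?_
    have h0 : (0 : ℝ) ≤ L := Nat.cast_nonneg L
    have hpos : 0 < √((L + 1 : ℕ) : ℝ) := Real.sqrt_pos.mpr (by positivity)
    have h1 := Real.sq_sqrt h0
    have h2 := Real.sq_sqrt (show (0 : ℝ) ≤ ((L + 1 : ℕ) : ℝ) by positivity)
    have h3 := Real.sqrt_nonneg (L : ℝ)
    set A := √((L + 1 : ℕ) : ℝ)
    set B := √(L : ℝ)
    have h4 : A ^ 2 = B ^ 2 + 1 := by rw [h1, h2]; push_cast; ring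
    have h5 : 1 / A * A = 1 := by field_simp
    by_contra hcon
    push Not at hcon
    nlinarith [mul_lt_mul_of_pos_right hcon hpos, sq_nonneg (A - B)]

theorem sum_netIndex (g : ℕ → ℝ) (L : ℕ) :
    ∑ q ∈ (Finset.univ : Finset Bool) ×ˢ (Finset.univ : Finset Bool) ×ˢ
      Finset.range L ×ˢ Finset.range L, g q.2.2.2 = 4 * (L * ∑ m ∈ Finset.range L, g m) := by
  simp only [Finset.sum_product, Finset.sum_const, Finset.card_univ, Fintype.card_bool,
    Finset.card_range, nsmul_eq_mul]
  push_cast; ring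

/-- Each row of the net has `O(R/s)` points. The row `m = 0` on the real axis contributes `b₀` per
point; a row at height `ms` contributes `b₁/√m`, and summing over `m` gives `O(b₁ √(R/s))`. -/
theorem pi_gapSet_le {ν : Fin n → Fin n → Measure ℝ} {κ : ℝ}
    [∀ j i, IsProbabilityMeasure (ν j i)] (hκ : 0 < κ) (hν : ∀ j i, SmallBall (ν j i) κ) {R s : ℝ}
    (hR : 1 ≤ R) (hs : 0 < s) (hs1 : s ≤ 1) :
    Measure.pi (fun j => Measure.pi (ν j)) (gapSet R s)
      ≤ ENNReal.ofReal (8 * (R / s) * (768 * κ ^ 2 * n ^ 3 * s ^ 2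
          + 64 * n ^ 2 * s ^ 2 * √((96 * κ ^ 2 * n) ^ 3 * (7 * R + 2 / (κ * √(n : ℝ))) * (2 * R)))) := by
  have hR0 : 0 < R := by linarith
  set L := ⌊R / s⌋₊ with hL
  set Q := 7 * R + 2 / (κ * √(n : ℝ)) with hQ
  have hQ0 : 0 ≤ Q := by positivity
  have hRs : 1 ≤ R / s := by rw [le_div_iff₀ hs]; linarith
  have hLR : (L : ℝ) ≤ R / s := Nat.floor_le (by positivity)
  set b₀ := 768 * κ ^ 2 * n ^ 3 * s ^ 2 with hb₀
  set b₁ := 32 * n ^ 2 * √((96 * κ ^ 2 * n) ^ 3 * Q * s ^ 5) with hb₁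
  have hb₀0 : 0 ≤ b₀ := by positivity
  have hb₁0 : 0 ≤ b₁ := by positivity
  have hpt : ∀ (σ σ' : Bool) (k m : ℕ), k < L + 1 → m < L + 1 →
      Measure.pi (fun j => Measure.pi (ν j)) (closePairSet (netPoint s (σ, σ', k, m)) R (8 * s ^ 2))
        ≤ ENNReal.ofReal ((if m = 0 then b₀ else 0) + b₁ * (1 / √(m : ℝ))) := by
    intro σ σ' k m hk hm
    have hbound : ∀ k : ℕ, k < L + 1 → (k : ℝ) * s ≤ R := by
      intro k hk
      have h1 : (k : ℝ) ≤ L := by exact_mod_cast Nat.lt_succ_iff.mp hk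
      rw [← le_div_iff₀ hs]
      exact h1.trans hLR
    by_cases hm0 : m = 0
    · refine (pi_closePairSet_le hκ hν _ R (by positivity)).trans (ENNReal.ofReal_le_ofReal ?_)
      simp only [hm0, if_true, Nat.cast_zero, Real.sqrt_zero, div_zero, mul_zero, add_zero]
      rw [hb₀]
      exact le_of_eq (by ring)
    · have hm1 : (0 : ℝ) < m := by exact_mod_cast Nat.pos_of_ne_zero hm0
      have hre : |(netPoint s (σ, σ', k, m)).re| ≤ 2 * R := by
        simp only [netPoint, abs_mul, abs_boolSign, one_mul, Nat.abs_cast, abs_of_pos hs]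
        linarith [hbound k hk]
      have him : |(netPoint s (σ, σ', k, m)).im| = m * s := by
        simp only [netPoint, abs_mul, abs_boolSign, one_mul, Nat.abs_cast, abs_of_pos hs]
      refine (pi_closePairSet_le_of_im hκ hν hR0 hre (by rw [him]; linarith [hbound m hm])
        (by rw [him]; positivity) (by positivity)).trans (ENNReal.ofReal_le_ofReal (le_of_eq ?_))
      rw [him, if_neg hm0, zero_add, hb₁, ← hQ, mul_assoc (32 * (n : ℝ) ^ 2), mul_one_div,
        ← Real.sqrt_div (by positivity)]
      congr 2
      field_simp
      ring
  refine (measure_mono (gapSet_subset hs)).trans ((measure_biUnion_finset_le _ _).trans ?_)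
  rw [← hL]
  have hsum : ∑ m ∈ Finset.range (L + 1), ((if m = 0 then b₀ else 0) + b₁ * (1 / √(m : ℝ)))
      ≤ b₀ + b₁ * (2 * √(R / s)) := by
    rw [Finset.sum_add_distrib, Finset.sum_ite_eq' (Finset.range (L + 1)) 0 fun _ => b₀,
      if_pos (by simp), ← Finset.mul_sum]
    gcongr
    exact (sum_one_div_sqrt_le L).trans (by gcongr)
  calc _ ≤ ∑ q ∈ (Finset.univ : Finset Bool) ×ˢ (Finset.univ : Finset Bool) ×ˢ
        Finset.range (L + 1) ×ˢ Finset.range (L + 1),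
        ENNReal.ofReal ((if q.2.2.2 = 0 then b₀ else 0) + b₁ * (1 / √(q.2.2.2 : ℝ))) := by
        refine Finset.sum_le_sum fun q hq => ?_
        simp only [Finset.mem_product, Finset.mem_univ, Finset.mem_range, true_and] at hq
        exact hpt q.1 q.2.1 q.2.2.1 q.2.2.2 hq.1 hq.2
    _ = ENNReal.ofReal (4 * ((L + 1 : ℕ) * ∑ m ∈ Finset.range (L + 1),
          ((if m = 0 then b₀ else 0) + b₁ * (1 / √(m : ℝ))))) := by
        rw [← ENNReal.ofReal_sum_of_nonneg]
        · congr 1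
          exact sum_netIndex (fun m => (if m = 0 then b₀ else 0) + b₁ * (1 / √(m : ℝ))) (L + 1)
        · intro q _
          have : 0 ≤ (if q.2.2.2 = 0 then b₀ else 0) := by split_ifs <;> simp [hb₀0]
          positivity
    _ ≤ ENNReal.ofReal (4 * (2 * (R / s) * (b₀ + b₁ * (2 * √(R / s))))) := by
        refine ENNReal.ofReal_le_ofReal ?_
        have h1 : ((L + 1 : ℕ) : ℝ) ≤ 2 * (R / s) := by push_cast; linarith
        have h2 : 0 ≤ b₀ + b₁ * (2 * √(R / s)) := by positivity
        refine mul_le_mul_of_nonneg_left ?_ (by norm_num)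
        exact (mul_le_mul_of_nonneg_left hsum (by positivity)).trans
          (mul_le_mul_of_nonneg_right h1 h2)
    _ ≤ _ := by
        refine ENNReal.ofReal_le_ofReal ?_
        have h3 : √((96 * κ ^ 2 * n) ^ 3 * Q * s ^ 5) * √(R / s)
            ≤ s ^ 2 * √((96 * κ ^ 2 * n) ^ 3 * Q * (2 * R)) := by
          rw [← Real.sqrt_mul (by positivity)]
          rw [show s ^ 2 = √((s ^ 2) ^ 2) from (Real.sqrt_sq (by positivity)).symm,
            ← Real.sqrt_mul (by positivity)]
          refine Real.sqrt_le_sqrt ?_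
          have : (96 * κ ^ 2 * n) ^ 3 * Q * s ^ 5 * (R / s)
              = (s ^ 2) ^ 2 * ((96 * κ ^ 2 * n) ^ 3 * Q * R) := by field_simp
          rw [this]
          gcongr
          linarith
        have h4 : b₁ * (2 * √(R / s))
            ≤ 64 * n ^ 2 * s ^ 2 * √((96 * κ ^ 2 * n) ^ 3 * Q * (2 * R)) := by
          rw [hb₁]
          nlinarith [mul_le_mul_of_nonneg_left h3 (show (0 : ℝ) ≤ 64 * (n : ℝ) ^ 2 by positivity)]
        have h5 : 0 ≤ R / s := by positivity
        nlinarith [mul_le_mul_of_nonneg_left h4 h5]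

/-! ### Operator norm, law of the columns and constants -/

theorem sum_sq_mulVec_le (M : Matrix (Fin n) (Fin n) ℝ) (p : Fin n → ℝ) :
    ∑ i, (M.mulVec p i) ^ 2 ≤ opNorm M ^ 2 * ∑ i, p i ^ 2 := by
  have h := (Matrix.toEuclideanCLM (𝕜 := ℝ) M).le_opNorm (WithLp.toLp 2 p)
  rw [Matrix.toEuclideanCLM_toLp] at h
  have h2 := pow_le_pow_left₀ (norm_nonneg _) h 2
  rw [mul_pow, EuclideanSpace.norm_sq_eq, EuclideanSpace.norm_sq_eq] at h2
  simpa [opNorm] using h2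

theorem opNorm_transpose (M : Matrix (Fin n) (Fin n) ℝ) : opNorm M.transpose = opNorm M := by
  have h : M.transpose = star M := by
    rw [Matrix.star_eq_conjTranspose, Matrix.conjTranspose_eq_transpose_of_trivial]
  rw [opNorm, opNorm, h, map_star, ContinuousLinearMap.star_eq_adjoint,
    LinearIsometryEquiv.norm_map]

theorem opNorm_add_smul_le {A G : Matrix (Fin n) (Fin n) ℝ} (hA : opNorm A ≤ 1) {δ K' : ℝ}
    (hδ : 0 ≤ δ) (hG : opNorm G ≤ K') : opNorm (A + δ • G) ≤ 1 + δ * K' := by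
  have h : opNorm (A + δ • G) ≤ opNorm A + δ * opNorm G := by
    simp only [opNorm]
    rw [map_add, map_smul]
    refine (norm_add_le _ _).trans ?_
    rw [norm_smul, Real.norm_of_nonneg hδ]
  have := mul_le_mul_of_nonneg_left hG hδ
  linarith

theorem normLe_of_opNorm_le {M : Matrix (Fin n) (Fin n) ℝ} {R : ℝ} (hM : opNorm M ≤ R) :
    NormLe R fun j i => M i j := by
  intro p
  have h := sum_sq_mulVec_le M.transpose p
  rw [opNorm_transpose] at h
  have h0 : 0 ≤ opNorm M := norm_nonneg _
  calc ∑ j, (∑ i, p i * M i j) ^ 2 = ∑ j, (M.transpose.mulVec p j) ^ 2 := by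
        simp only [Matrix.mulVec, dotProduct, Matrix.transpose_apply, mul_comm]
    _ ≤ opNorm M ^ 2 * ∑ i, p i ^ 2 := h
    _ ≤ _ := by gcongr

/-- The operator norm is taken over real vectors, so it is applied separately to the real and
imaginary parts of `v`. -/
theorem norm_eigenvalue_le {M : Matrix (Fin n) (Fin n) ℝ} {a : ℂ} {v : Fin n → ℂ}
    (hv : (M.map (algebraMap ℝ ℂ)).mulVec v = a • v) (hv1 : ∑ i, ‖v i‖ ^ 2 = 1) :
    ‖a‖ ≤ opNorm M := by
  have h0 : 0 ≤ opNorm M := norm_nonneg _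
  refine le_of_sq_le_sq ?_ h0
  have hre : ∀ i, (a * v i).re = M.mulVec (fun l => (v l).re) i := by
    intro i
    have h := congrArg Complex.re (congrFun hv i)
    simp only [Matrix.mulVec, dotProduct, Matrix.map_apply, Complex.coe_algebraMap,
      Pi.smul_apply, smul_eq_mul, Complex.re_sum, Complex.re_ofReal_mul] at h ⊢
    exact h.symm
  have him : ∀ i, (a * v i).im = M.mulVec (fun l => (v l).im) i := by
    intro i
    have h := congrArg Complex.im (congrFun hv i)
    simp only [Matrix.mulVec, dotProduct, Matrix.map_apply, Complex.coe_algebraMap,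
      Pi.smul_apply, smul_eq_mul, Complex.im_sum, Complex.im_ofReal_mul] at h ⊢
    exact h.symm
  calc ‖a‖ ^ 2 = ∑ i, ‖a * v i‖ ^ 2 := by
        simp_rw [norm_mul, mul_pow, ← Finset.mul_sum]
        rw [hv1, mul_one]
    _ = ∑ i, (M.mulVec (fun l => (v l).re) i) ^ 2 + ∑ i, (M.mulVec (fun l => (v l).im) i) ^ 2 := by
        rw [← Finset.sum_add_distrib]
        refine Finset.sum_congr rfl fun i _ => ?_
        rw [← hre, ← him, Complex.sq_norm, Complex.normSq_apply]; ring
    _ ≤ opNorm M ^ 2 * ∑ i, (v i).re ^ 2 + opNorm M ^ 2 * ∑ i, (v i).im ^ 2 :=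
        add_le_add (sum_sq_mulVec_le M _) (sum_sq_mulVec_le M _)
    _ = opNorm M ^ 2 * ∑ i, ‖v i‖ ^ 2 := by
        rw [← mul_add, ← Finset.sum_add_distrib]
        congr 1
        refine Finset.sum_congr rfl fun i _ => ?_
        rw [Complex.sq_norm, Complex.normSq_apply]; ring
    _ = _ := by rw [hv1, mul_one]

theorem mem_gapSet {M : Matrix (Fin n) (Fin n) ℝ} {R s : ℝ} (hs : 0 < s) (hM : opNorm M ≤ R)
    (hgap : gap M ≤ ENNReal.ofReal s) : (fun j i => M i j) ∈ gapSet R s := by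
  -- Passing to the strict bound `2s` yields a pair of eigenvalues without showing that the infimum
  -- is attained.
  have hlt : gap M < ENNReal.ofReal (2 * s) :=
    hgap.trans_lt ((ENNReal.ofReal_lt_ofReal_iff (by linarith)).mpr (by linarith))
  simp only [gap, iInf_lt_iff] at hlt
  obtain ⟨a, b, hab, hlt⟩ := hlt
  obtain ⟨v, w, hvw, hv, -⟩ := exists_orthoPair_triangular _ hab
  refine ⟨normLe_of_opNorm_le hM, a, b, hab, (norm_eigenvalue_le hv hvw.1).trans hM, ?_⟩
  rw [← ofReal_norm, ENNReal.ofReal_lt_ofReal_iff (by linarith)] at hlt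
  exact hlt.le

/-- A product measure on a product index, in columns. -/
theorem map_columns_pi (μ : Fin n × Fin n → Measure ℝ) [∀ p, IsProbabilityMeasure (μ p)] :
    (Measure.pi μ).map (fun f j i => f (i, j))
      = Measure.pi fun j => Measure.pi fun i => μ (i, j) := by
  have h1 : Measurable fun (x : Fin n → Fin n → ℝ) (p : Fin n × Fin n) => x p.2 p.1 := by
    fun_prop
  have h2 : Measurable fun (f : Fin n × Fin n → ℝ) (j i : Fin n) => f (i, j) := by
    fun_prop
  have h : Measure.pi μ = (Measure.pi fun j => Measure.pi fun i => μ (i, j)).map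
      fun x p => x p.2 p.1 := by
    refine Measure.pi_eq fun s hs => ?_
    rw [Measure.map_apply h1 (MeasurableSet.univ_pi hs)]
    have hpre : (fun (x : Fin n → Fin n → ℝ) (p : Fin n × Fin n) => x p.2 p.1) ⁻¹'
        (Set.univ.pi s) = Set.univ.pi fun j => Set.univ.pi fun i => s (i, j) := by
      ext x
      simp only [Set.mem_preimage, Set.mem_pi, Set.mem_univ, true_implies, Prod.forall]
      exact forall_comm
    rw [hpre, Measure.pi_pi]
    simp_rw [Measure.pi_pi]
    rw [Fintype.prod_prod_type, Finset.prod_comm]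
  rw [h, Measure.map_map h2 h1]
  exact Measure.map_id

theorem HasDensityBoundedBy.measure_le {Ω' : Type*} [MeasurableSpace Ω'] {P' : Measure Ω'}
    {ξ : Ω' → ℝ} {K : ℝ} (h : HasDensityBoundedBy ξ P' K) (S : Set ℝ) :
    P'.map ξ S ≤ ENNReal.ofReal K * volume S := by
  have := h.1
  rw [map_eq_withDensity_pdf ξ P' volume]
  calc _ ≤ (volume.withDensity fun _ => ENNReal.ofReal K) S := withDensity_mono h.2 S
    _ = _ := by simp

theorem HasDensityBoundedBy.pos {Ω' : Type*} [MeasurableSpace Ω'] {P' : Measure Ω'}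
    [IsProbabilityMeasure P'] {ξ : Ω' → ℝ} {K : ℝ} (h : HasDensityBoundedBy ξ P' K) : 0 < K := by
  by_contra hK
  have h1 := h.measure_le Set.univ
  rw [ENNReal.ofReal_of_nonpos (not_lt.mp hK), zero_mul] at h1
  have := h.1
  have h2 : IsProbabilityMeasure (P'.map ξ) :=
    Measure.isProbabilityMeasure_map (HasPDF.aemeasurable ξ P' volume)
  rw [measure_univ] at h1
  simp at h1

theorem HasDensityBoundedBy.smallBall {Ω' : Type*} [MeasurableSpace Ω'] {P' : Measure Ω'}
    [IsProbabilityMeasure P'] {ξ : Ω' → ℝ} {K : ℝ} (h : HasDensityBoundedBy ξ P' K) :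
    SmallBall (P'.map ξ) K := by
  intro c r hr
  refine (h.measure_le _).trans (le_of_eq ?_)
  rw [Real.volume_closedBall, ← ENNReal.ofReal_mul h.pos.le]
  congr 1; ring

theorem SmallBall.map_affine {ν : Measure ℝ} {K : ℝ} (h : SmallBall ν K) (a : ℝ) {d : ℝ}
    (hd : 0 < d) : SmallBall (ν.map fun u => a + d * u) (K / d) := by
  intro c r hr
  rw [Measure.map_apply (by fun_prop) Metric.isClosed_closedBall.measurableSet]
  have hsub : (fun u => a + d * u) ⁻¹' Metric.closedBall c r
      ⊆ Metric.closedBall ((c - a) / d) (r / d) := by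
    intro u hu
    simp only [Set.mem_preimage, Metric.mem_closedBall, Real.dist_eq] at hu ⊢
    rw [le_div_iff₀ hd, ← abs_of_pos hd, ← abs_mul, abs_of_pos hd]
    have : (u - (c - a) / d) * d = a + d * u - c := by field_simp; ring
    rwa [this]
  refine (measure_mono hsub).trans ((h _ _ (by positivity)).trans (le_of_eq ?_))
  congr 1; ring

/-- The law of the columns of `A + δ G`. -/
theorem exists_law_columns {Ω Ω' : Type*} [MeasurableSpace Ω] [MeasurableSpace Ω']
    {P : Measure Ω} [IsProbabilityMeasure P] {P' : Measure Ω'} [IsProbabilityMeasure P']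
    {ξ : Ω' → ℝ} {K : ℝ} (hξ : HasDensityBoundedBy ξ P' K) (hn : 0 < n)
    {G : Ω → Matrix (Fin n) (Fin n) ℝ} (hG : IsScaledIIDMatrix G P ξ P')
    (A : Matrix (Fin n) (Fin n) ℝ) {δ : ℝ} (hδ : 0 < δ) :
    ∃ ν : Fin n → Fin n → Measure ℝ, (∀ j i, IsProbabilityMeasure (ν j i)) ∧
      (∀ j i, SmallBall (ν j i) (K / (δ / √(n : ℝ)))) ∧
      AEMeasurable (fun ω j i => (A + δ • G ω) i j) P ∧
      P.map (fun ω j i => (A + δ • G ω) i j) = Measure.pi fun j => Measure.pi (ν j) := by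
  have hsn : 0 < √(n : ℝ) := Real.sqrt_pos.mpr (by exact_mod_cast hn)
  let Y : Fin n × Fin n → Ω → ℝ := fun p ω => (A + δ • G ω) p.1 p.2
  have hY : ∀ p : Fin n × Fin n, Y p = (fun u => A p.1 p.2 + δ / √(n : ℝ) * u) ∘
      fun ω => √(n : ℝ) * G ω p.1 p.2 := by
    intro p
    ext ω
    simp only [Y, Matrix.add_apply, Matrix.smul_apply, smul_eq_mul, Function.comp_apply]
    field_simp
  have hmeas : ∀ p, AEMeasurable (Y p) P := by
    intro p
    rw [hY]
    exact Measurable.comp_aemeasurable (by fun_prop) (hG.2 p.1 p.2).aemeasurable_fst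
  have hmeas' : AEMeasurable (fun ω p => Y p ω) P := aemeasurable_pi_lambda _ hmeas
  have hind : iIndepFun Y P := by
    have := hG.1.comp (fun p u => A p.1 p.2 + δ / √(n : ℝ) * u) fun p => by fun_prop
    rwa [show Y = fun p => (fun u => A p.1 p.2 + δ / √(n : ℝ) * u) ∘
      fun ω => √(n : ℝ) * G ω p.1 p.2 from funext hY]
  have hprob : ∀ p, IsProbabilityMeasure (P.map (Y p)) := fun p =>
    Measure.isProbabilityMeasure_map (hmeas p)
  have hcol : Measurable fun (f : Fin n × Fin n → ℝ) (j i : Fin n) => f (i, j) := by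
    fun_prop
  refine ⟨fun j i => P.map (Y (i, j)), fun j i => hprob _, fun j i => ?_,
    hcol.comp_aemeasurable hmeas', ?_⟩
  · change SmallBall (P.map (Y (i, j))) _
    rw [hY, ← AEMeasurable.map_map_of_aemeasurable (by fun_prop) (hG.2 i j).aemeasurable_fst,
      (hG.2 i j).map_eq]
    exact hξ.smallBall.map_affine _ (by positivity)
  · have h1 := hind.map_fun_eq_pi_map hmeas
    rw [← map_columns_pi (fun p => P.map (Y p)), ← h1,
      AEMeasurable.map_map_of_aemeasurable hcol.aemeasurable hmeas']
    rfl

/-- The two terms of the probability bound in terms of the original parameters. -/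
theorem bound_le {n K δ R s : ℝ} (hn : 1 ≤ n) (hK : 0 < K) (hδ : 0 < δ) (hδ1 : δ < 1)
    (hR : 1 ≤ R) (hs : 0 < s) :
    8 * (R / s) * (768 * (K / (δ / √n)) ^ 2 * n ^ 3 * s ^ 2
        + 64 * n ^ 2 * s ^ 2 * √((96 * (K / (δ / √n)) ^ 2 * n) ^ 3
          * (7 * R + 2 / (K / (δ / √n) * √n)) * (2 * R)))
      ≤ 3000000 * (R ^ 2 * max (K ^ 2) (K ^ 3) * n ^ 5 * (s / δ ^ 3)) := by
  have hn0 : 0 < n := by linarith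
  have hR0 : 0 < R := by linarith
  have hsn : 0 < √n := Real.sqrt_pos.mpr hn0
  have hsq : √n ^ 2 = n := Real.sq_sqrt hn0.le
  set m := max (K ^ 2) (K ^ 3) with hm
  have hm2 : K ^ 2 ≤ m := le_max_left _ _
  have hm3 : K ^ 3 ≤ m := le_max_right _ _
  have hm0 : 0 < m := lt_of_lt_of_le (by positivity) hm2
  have e1 : (K / (δ / √n)) ^ 2 = K ^ 2 * n / δ ^ 2 := by
    rw [div_div_eq_mul_div, div_pow, mul_pow, hsq]
  have e2 : K / (δ / √n) * √n = K * n / δ := by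
    rw [div_div_eq_mul_div, div_mul_eq_mul_div, mul_assoc, ← sq, hsq]
  rw [e1, e2]
  -- `H` dominates both `g ^ 2` and `g ^ 3`, where `g = κ√n = Kn/δ`; the square uses `n/δ ≥ 1`. This
  -- is the origin of `max (K ^ 2) (K ^ 3)` and of `δ ^ 3`.
  set H := m * n ^ 3 / δ ^ 3 with hH
  have hH0 : 0 < H := by positivity
  set g := K * n / δ with hg
  have hg0 : 0 < g := by positivity
  have hδn : 1 ≤ n / δ := by rw [le_div_iff₀ hδ]; linarith
  have hgH3 : g ^ 3 ≤ H := by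
    calc g ^ 3 = K ^ 3 * n ^ 3 / δ ^ 3 := by rw [hg]; ring
      _ ≤ _ := by rw [hH]; gcongr
  have hgH2 : g ^ 2 ≤ H := by
    calc g ^ 2 = K ^ 2 * (n / δ) ^ 2 := by rw [hg]; ring
      _ ≤ m * (n / δ) ^ 3 := by
          gcongr
          norm_num
      _ = H := by rw [hH]; ring
  have hsqrt : √((96 * (K ^ 2 * n / δ ^ 2) * n) ^ 3 * (7 * R + 2 / g) * (2 * R))
      ≤ 4000 * (H * R) := by
    rw [Real.sqrt_le_iff]
    refine ⟨by positivity, ?_⟩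
    have e3 : (96 * (K ^ 2 * n / δ ^ 2) * n) ^ 3 * (7 * R + 2 / g) * (2 * R)
        = 96 ^ 3 * (14 * (g ^ 3 * g ^ 3) * R ^ 2 + 4 * (g ^ 3 * g ^ 2) * R) := by
      rw [show 96 * (K ^ 2 * n / δ ^ 2) * n = 96 * g ^ 2 by rw [hg]; ring]
      field_simp
      ring
    rw [e3]
    calc _ ≤ 96 ^ 3 * (14 * (H * H) * R ^ 2 + 4 * (H * H) * R ^ 2) := by
          gcongr
          nlinarith
      _ = 15925248 * (H * R) ^ 2 := by ring
      _ ≤ 16000000 * (H * R) ^ 2 := by gcongr; norm_num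
      _ = _ := by ring
  calc _ ≤ 8 * (R / s) * (768 * H * n ^ 2 * s ^ 2 + 64 * n ^ 2 * s ^ 2 * (4000 * (H * R))) := by
        have h4 : 768 * (K ^ 2 * n / δ ^ 2) * n ^ 3 ≤ 768 * H * n ^ 2 := by
          have : K ^ 2 * n / δ ^ 2 * n = g ^ 2 := by rw [hg]; ring
          nlinarith [mul_le_mul_of_nonneg_right hgH2 (show 0 ≤ 768 * n ^ 2 by positivity)]
        gcongr
    _ = 8 * R * H * n ^ 2 * s * (768 + 256000 * R) := by field_simp; ring
    _ ≤ 8 * R * H * n ^ 2 * s * (375000 * R) := by gcongr; linarith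
    _ = _ := by rw [hH]; field_simp; norm_num

end EigenvalueGap

end

/-! ### Assembly -/

theorem mainTheorem3 :
    ∃ c : ℝ, 0 < c ∧
      ∀ {Ω Ω' : Type*} [MeasurableSpace Ω] [MeasurableSpace Ω']
        (P : Measure Ω) [IsProbabilityMeasure P] (P' : Measure Ω') [IsProbabilityMeasure P']
        (ξ : Ω' → ℝ) (K : ℝ)
        (_ : EigenvalueGap.IsSubGaussian ξ P') (_ : EigenvalueGap.HasDensityBoundedBy ξ P' K)
        (n : ℕ) (G : Ω → Matrix (Fin n) (Fin n) ℝ)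
        (_ : EigenvalueGap.IsScaledIIDMatrix G P ξ P')
        (A : Matrix (Fin n) (Fin n) ℝ) (_ : EigenvalueGap.opNorm A ≤ 1)
        (δ : ℝ) (_ : 0 < δ) (_ : δ < 1) (K' : ℝ) (_ : 0 ≤ K') (s : ℝ) (_ : 0 < s) (_ : s ≤ 1),
        P.real {ω | EigenvalueGap.opNorm (G ω) ≤ K' ∧
            EigenvalueGap.gap (A + δ • G ω) ≤ ENNReal.ofReal s} ≤
          c * Real.logb 2 (2 * (1 + δ * K') / s) * (1 + δ * K') ^ 2 * max (K ^ 2) (K ^ 3) *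
            (n : ℝ) ^ 5 * (s / δ ^ 3) := by
  refine ⟨3000000, by norm_num, ?_⟩
  intro Ω Ω' _ _ P _ P' _ ξ K _ hξ n G hG A hA δ hδ hδ1 K' hK' s hs hs1
  have hK : 0 < K := hξ.pos
  have hR : 1 ≤ 1 + δ * K' := by nlinarith
  have hsub : {ω | EigenvalueGap.opNorm (G ω) ≤ K' ∧
      EigenvalueGap.gap (A + δ • G ω) ≤ ENNReal.ofReal s}
      ⊆ (fun ω j i => (A + δ • G ω) i j) ⁻¹' EigenvalueGap.gapSet (1 + δ * K') s :=
    fun ω hω => EigenvalueGap.mem_gapSet hs (EigenvalueGap.opNorm_add_smul_le hA hδ.le hω.1) hω.2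
  rcases Nat.eq_zero_or_pos n with rfl | hn
  · have hempty : EigenvalueGap.gapSet (n := 0) (1 + δ * K') s = ∅ := by
      refine Set.eq_empty_of_forall_notMem fun x hx => ?_
      obtain ⟨-, a, b, hab, -⟩ := hx
      obtain ⟨v, w, hvw, -⟩ := EigenvalueGap.exists_orthoPair_triangular _ hab
      simpa using hvw.1
    rw [hempty, Set.preimage_empty, Set.subset_empty_iff] at hsub
    rw [hsub]
    simp
  have hn1 : (1 : ℝ) ≤ n := by exact_mod_cast hn
  obtain ⟨ν, hprob, hν, hmeas, hlaw⟩ := EigenvalueGap.exists_law_columns hξ hn hG A hδ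
  have hκ : 0 < K / (δ / √(n : ℝ)) := by positivity
  -- The argument of the logarithm is at least two because `s ≤ 1 ≤ 1 + δK'`.
  have hlog : 1 ≤ Real.logb 2 (2 * (1 + δ * K') / s) := by
    rw [Real.le_logb_iff_rpow_le (by norm_num) (by positivity), Real.rpow_one,
      le_div_iff₀ hs]
    nlinarith
  have hbound : P {ω | EigenvalueGap.opNorm (G ω) ≤ K' ∧
      EigenvalueGap.gap (A + δ • G ω) ≤ ENNReal.ofReal s}
      ≤ ENNReal.ofReal (3000000 * ((1 + δ * K') ^ 2 * max (K ^ 2) (K ^ 3) * (n : ℝ) ^ 5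
        * (s / δ ^ 3))) := by
    -- This direction of the pushforward inequality holds for arbitrary sets, so `gapSet` need not
    -- be measurable.
    refine (measure_mono hsub).trans ((Measure.le_map_apply hmeas _).trans ?_)
    rw [hlaw]
    exact (EigenvalueGap.pi_gapSet_le hκ hν hR hs hs1).trans
      (ENNReal.ofReal_le_ofReal (EigenvalueGap.bound_le hn1 hK hδ hδ1 hR hs))
  have hm : 0 < max (K ^ 2) (K ^ 3) := lt_of_lt_of_le (by positivity) (le_max_left _ _)
  refine (ENNReal.toReal_le_of_le_ofReal (by positivity) hbound).trans ?_
  calc _ ≤ 3000000 * ((1 + δ * K') ^ 2 * max (K ^ 2) (K ^ 3) * (n : ℝ) ^ 5 * (s / δ ^ 3))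
        * Real.logb 2 (2 * (1 + δ * K') / s) := le_mul_of_one_le_right (by positivity) hlog
    _ = _ := by ring
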